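/- A graph $G=(H,E,V)$ consists of a finite set $H$ of half-edges, an involution $E$ of $H$ and a partition $V$ of $H$. The blocks of $V$ are the vertices and the two-element orbits of $E$ are the edges; their numbers are $v(G)$ and $e(G)$, and $\chi(G)=v(G)-e(G)$. An isomorphism of graphs is a bijection of the half-edges that commutes with the involutions and respects the partitions, and $\mathrm{Aut}(G)$ is the group of automorphisms of $G$. In this statement $G$ is admissible if $E$ has no fixed points (there are no leaves) and every block of $V$ has at least three elements. Let $\mathcal G_c$ be the set of isomorphism classes of non-empty connected admissible graphs, and $$\mathcal X(\hbar)=\sum_{G\in\mathcal G_c}(-1)^{e(G)}\,\frac{\hbar^{-\chi(G)}}{|\mathrm{Aut}(G)|}\in\mathbb Q[[\hbar]].$$ The even commutative graph complex $\mathcal{GC}_2^{(n)}$ is generated by the graphs $G\in\mathcal G_c$ whose fundamental group is free of rank $n$, with $G$ placed in degree $e(G)$. Its orbifold Euler characteristic is defined on the chain level, by counting each such graph $G$, with the sign of its degree, with weight $1/|\mathrm{Aut}(G)|$: $$\chi(\mathcal{GC}_2^{(n)})=\sum_{G\in\mathcal G_c,\ \pi_1(G)\cong F_n}\frac{(-1)^{e(G)}}{|\mathrm{Aut}(G)|}.$$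 Then for every integer $n\ge 1$ there are only finitely many $G\in\mathcal G_c$ with $\pi_1(G)\cong F_{n+1}$ and only finitely many with $\chi(G)=-n$, and $$\chi(\mathcal{GC}_2^{(n+1)})=[\hbar^n]\,\mathcal X(\hbar)=\sum_{G\in\mathcal G_c,\ \chi(G)=-n}\frac{(-1)^{e(G)}}{|\mathrm{Aut}(G)|}=\begin{cases}0&\text{if } n \text{ is even},\\[4pt]-\dfrac{B_{n+1}}{n(n+1)}&\text{if } n\text{ is odd},\end{cases}$$ where the Bernoulli numbers $B_k$ are defined by $\sum_{k\ge 0}B_k\,x^k/k!=x/(e^x-1)$. -/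

import Mathlib

open CategoryTheory

noncomputable section

/-- A graph is a triple `(H, E, V)`: a finite set `H` of half-edges, an involution `E` of `H` whose
orbits are the edges (two-element orbits) and leaves (fixed points), and a partition `V` of `H`,
given as an equivalence relation, whose blocks are the vertices. -/
structure HGraph where
  H : Type
  finite_H : Finite H
  E : H → H
  E_involutive : Function.Involutive E
  V : Setoid H

namespace HGraph

attribute [instance] HGraph.finite_H

/-- The vertices are the blocks of the partition `V`. -/
def Vertex (G : HGraph) : Type := Quotient G.V

/-- The vertex at which a half-edge is attached. -/
def vert (G : HGraph) (h : G.H) : G.Vertex := Quotient.mk G.V h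

/-- The edges are the two-element orbits of the involution `E`. -/
def edges (G : HGraph) : Set (Set G.H) := {s | ∃ h : G.H, G.E h ≠ h ∧ s = {h, G.E h}}

/-- The number `v(G)` of vertices. -/
def v (G : HGraph) : ℕ := Nat.card G.Vertex

/-- The number `e(G)` of edges. -/
def e (G : HGraph) : ℕ := G.edges.ncard

/-- The Euler characteristic `χ(G) = v(G) - e(G)`. -/
def eulerChar (G : HGraph) : ℤ := (G.v : ℤ) - (G.e : ℤ)

/-- Admissible graphs without leaves: `E` has no fixed point, and every block of `V` has at least
three elements. -/
def Admissible (G : HGraph) : Prop :=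
  (∀ h : G.H, G.E h ≠ h) ∧ ∀ h : G.H, 3 ≤ {k : G.H | G.V h k}.ncard

/-- `G` is connected: it is not the empty graph, and any two half-edges are joined by a chain of
half-edges in which neighbours belong to the same vertex or to the same edge. -/
def Connected (G : HGraph) : Prop :=
  Nonempty G.H ∧
    ∀ h k : G.H, Relation.ReflTransGen (fun a b => G.V a b ∨ b = G.E a) h k

/-- An isomorphism of graphs is a bijection between the half-edges that commutes with the
involutions and respects the partitions. -/
structure Iso (G G' : HGraph) where
  toEquiv : G.H ≃ G'.H
  map_E : ∀ h : G.H, toEquiv (G.E h) = G'.E (toEquiv h)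
  map_V : ∀ h k : G.H, G.V h k ↔ G'.V (toEquiv h) (toEquiv k)

/-- The automorphisms of `G`. -/
abbrev Aut (G : HGraph) : Type := Iso G G

/-- The identity isomorphism. -/
def Iso.refl (G : HGraph) : Iso G G := ⟨Equiv.refl _, fun _ => rfl, fun _ _ => Iff.rfl⟩

/-- The inverse isomorphism. -/
def Iso.symm {G G' : HGraph} (f : Iso G G') : Iso G' G where
  toEquiv := f.toEquiv.symm
  map_E h := by
    rw [Equiv.symm_apply_eq, f.map_E, Equiv.apply_symm_apply]
  map_V h k := by
    rw [f.map_V, Equiv.apply_symm_apply, Equiv.apply_symm_apply]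

/-- Composition of isomorphisms. -/
def Iso.trans {G G' G'' : HGraph} (f : Iso G G') (g : Iso G' G'') : Iso G G'' where
  toEquiv := f.toEquiv.trans g.toEquiv
  map_E h := by simp [f.map_E, g.map_E]
  map_V h k := by simp [f.map_V, g.map_V]

/-! ### The fundamental group -/

/-- The vertices form a quiver: an arrow from `a` to `b` is an oriented edge from `a` to `b`, that
is, a half-edge `h` at `a` whose opposite half-edge `E h` is at `b`. -/
instance quiver (G : HGraph) : Quiver G.Vertex where
  Hom a b := {h : G.H // G.vert h = a ∧ G.vert (G.E h) = b}

/-- The oriented edge `h` traversed backwards. -/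
def reverse (G : HGraph) {a b : G.Vertex} (h : a ⟶ b) : b ⟶ a :=
  ⟨G.E h.1, h.2.2, by rw [G.E_involutive h.1]; exact h.2.1⟩

/-- The elementary homotopies of edge paths: traversing an edge and going straight back is
homotopic to the constant path. -/
inductive Backtrack (G : HGraph) : HomRel (Paths G.Vertex)
  | cancel {a b : G.Vertex} (h : a ⟶ b) :
      Backtrack G (X := (Paths.of G.Vertex).obj a) (Y := (Paths.of G.Vertex).obj a)
        ((Paths.of G.Vertex).map h ≫ (Paths.of G.Vertex).map (G.reverse h)) (𝟙 _)

/-- The fundamental groupoid: vertices and homotopy classes of edge paths. -/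
abbrev FundGroupoid (G : HGraph) : Type := CategoryTheory.Quotient G.Backtrack

/-- The fundamental group of `G` at a vertex `a`: the homotopy classes of closed edge paths at `a`
under concatenation. -/
abbrev FundGroup (G : HGraph) (a : G.Vertex) : Type :=
  End ((CategoryTheory.Quotient.functor G.Backtrack).obj ((Paths.of G.Vertex).obj a))

/-- The fundamental group of `G` (at every base vertex) is a free group of rank `n`. -/
def HasFreeFundGroup (G : HGraph) (n : ℕ) : Prop :=
  ∀ a : G.Vertex, Nonempty (G.FundGroup a ≃* FreeGroup (Fin n))

end HGraph

/-- Connected admissible graphs (without leaves). -/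
def ConnGraph : Type 1 := {G : HGraph // G.Admissible ∧ G.Connected}

/-- Isomorphism of connected admissible graphs. -/
def ConnGraph.setoid : Setoid ConnGraph where
  r G G' := Nonempty (HGraph.Iso G.1 G'.1)
  iseqv :=
    { refl := fun G => ⟨HGraph.Iso.refl G.1⟩
      symm := fun ⟨f⟩ => ⟨f.symm⟩
      trans := fun ⟨f⟩ ⟨g⟩ => ⟨f.trans g⟩ }

/-- The set `𝒢_c` of isomorphism classes of connected admissible graphs. -/
def ConnClass : Type 1 := Quotient ConnGraph.setoid

/-- A graph representing an isomorphism class. Everything below depends only on the class. -/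
def ConnClass.rep (c : ConnClass) : HGraph := (Quotient.out c).1

/-- The classes of the connected admissible graphs with Euler characteristic `-n`. -/
def classesOfEulerChar (n : ℕ) : Set ConnClass := {c | c.rep.eulerChar = -(n : ℤ)}

/-- The formal power series `𝒳(ħ) = ∑_{G ∈ 𝒢_c} (-1)^{e(G)} ħ^{-χ(G)} / |Aut(G)|`. -/
def seriesX : PowerSeries ℚ :=
  PowerSeries.mk fun n =>
    ∑ᶠ c ∈ classesOfEulerChar n, (-1 : ℚ) ^ c.rep.e / (Nat.card c.rep.Aut : ℚ)

namespace GC2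

/-- The graphs that generate the even commutative graph complex `GC_2^{(n)}`: the connected
admissible graphs whose fundamental group is free of rank `n`, up to isomorphism. -/
def generators (n : ℕ) : Set ConnClass := {c | c.rep.HasFreeFundGroup n}

/-- The degree of a generator is its number of edges. -/
def degree (c : ConnClass) : ℕ := c.rep.e

/-- The orbifold Euler characteristic of `GC_2^{(n)}`: the alternating count of the generating
graphs `G` by degree, each with weight `1 / |Aut(G)|`. -/
def orbifoldEulerChar (n : ℕ) : ℚ :=
  ∑ᶠ c ∈ generators n, (-1 : ℚ) ^ degree c * (1 / (Nat.card c.rep.Aut : ℚ))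

end GC2

end

open CategoryTheory

noncomputable section

/-! ### Power series with polynomial coefficients -/

namespace PolySeries

open PowerSeries

/-! Put ħ = t². A graph gets the weight (-1)^e t^(|H| - 2v), where |H| - 2v = -2χ in the absence of
leaves. By orbit counting, a graph with N half-edges has N!/|Aut| labellings up to isomorphism, so
the sum over classes is the value at y = 1 of the exponential generating function in N of the
connected labelled graphs (`finsum_classesOfEulerChar`). Blocks of size at least three force |H| ≤
3(|H| - 2v); hence every coefficient in t is a polynomial in y, and the classes with given χ are
finite in number.

Splitting off the component of one half-edge (`total_fin_succ`) gives P_y = Q_y P for the series P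
of all structures and Q of connected ones, that is, P = exp Q. A graph is an independent choice of a
perfect matching and a partition. The series of partitions is the exponential of `potential` =
(e^(ty) - 1 - ty - t²y²/2)/t². The signed numbers of matchings are the moments of the functional L
with L(yp) = -L(p'), formally integration against e^(y²/2). So all graphs together give Z = L(exp
potential), formally the integral of exp((e^x - 1 - x)/ħ) with x = ty, and the wanted series is F =
log Z.

Z is evaluated like the Gamma function (`coeff_log_formal_integral`). For M_s = L(e^(sty) P),
integration by parts gives M_(s+1) = (1 - s t²) M_s. The logarithmic t-derivative of M_s then
involves power sums of 0, ..., s - 1, which are Faulhaber polynomials in s. The identity therefore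
holds for s as a variable, and its s-derivative at 0 produces Bernoulli numbers: with U = t L(yP),
t(U/Z)' = -2 ∑ B_k t^(2k), summed over k ≥ 1. A second relation, t³Z' = 2U - t²Z, turns this into
t(t² + t³F')' = -4 ∑ B_k t^(2k), from which the coefficients of F are read off.

For the graph complex, the fundamental groupoid is free on the edges, so its vertex groups are free.
Counting homomorphisms to a group of order two gives the rank e - v + 1 (`hasFreeFundGroup_iff`), so
rank n + 1 means χ = -n. -/

theorem derivative_mul {R : Type*} [CommRing R] (f g : PowerSeries R) :
    derivative R (f * g) = derivative R f * g + f * derivative R g := by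
  rw [Derivation.leibniz, smul_eq_mul, smul_eq_mul]
  ring

theorem derivative_sub {R : Type*} [CommRing R] (f g : PowerSeries R) :
    derivative R (f - g) = derivative R f - derivative R g := map_sub _ _ _

theorem derivative_ofNat {R : Type*} [CommRing R] (n : ℕ) [n.AtLeastTwo] :
    derivative R (OfNat.ofNat n : PowerSeries R) = 0 := by
  rw [← Nat.cast_ofNat]
  exact Derivation.map_natCast _ _

/-- The application of a linear map to every coefficient of a power series. -/
def mapCoeff {B : Type*} [AddCommGroup B] [Module ℚ B] (φ : Polynomial ℚ →ₗ[ℚ] B) :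
    PowerSeries (Polynomial ℚ) →ₗ[ℚ] PowerSeries B where
  toFun f := fun n => φ (f n)
  map_add' f g := by funext n; exact map_add φ _ _
  map_smul' a f := by funext n; exact map_smul φ _ _

theorem coeff_mapCoeff {B : Type*} [CommRing B] [Algebra ℚ B] (φ : Polynomial ℚ →ₗ[ℚ] B)
    (f : PowerSeries (Polynomial ℚ)) (n : ℕ) : coeff n (mapCoeff φ f) = φ (coeff n f) := rfl

/-- The coefficientwise derivative. -/
def dy : PowerSeries (Polynomial ℚ) →ₗ[ℚ] PowerSeries (Polynomial ℚ) :=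
  mapCoeff Polynomial.derivative

theorem coeff_dy (f : PowerSeries (Polynomial ℚ)) (n : ℕ) :
    coeff n (dy f) = Polynomial.derivative (coeff n f) := rfl

theorem dy_mul (f g : PowerSeries (Polynomial ℚ)) : dy (f * g) = dy f * g + f * dy g := by
  ext1 n
  simp only [coeff_dy, coeff_mul, map_add, map_sum, Polynomial.derivative_mul,
    Finset.sum_add_distrib]

theorem dy_one : dy 1 = 0 := by
  ext1 n
  rw [coeff_dy, coeff_one]
  split_ifs <;> simp

theorem dy_derivative (f : PowerSeries (Polynomial ℚ)) :
    dy (derivative (Polynomial ℚ) f) = derivative (Polynomial ℚ) (dy f) := by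
  ext1 n
  rw [coeff_dy, coeff_derivative, coeff_derivative, coeff_dy, Polynomial.derivative_mul]
  simp

/-- The coefficientwise evaluation. -/
def ev (a : ℚ) : PowerSeries (Polynomial ℚ) →+* PowerSeries ℚ :=
  PowerSeries.map (Polynomial.evalRingHom a)

theorem coeff_ev (a : ℚ) (f : PowerSeries (Polynomial ℚ)) (n : ℕ) :
    coeff n (ev a f) = (coeff n f).eval a := by
  simp [ev]

theorem ev_derivative (a : ℚ) (f : PowerSeries (Polynomial ℚ)) :
    ev a (derivative (Polynomial ℚ) f) = derivative ℚ (ev a f) := by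
  ext1 n
  simp [coeff_ev, coeff_derivative]

/-- Since k has no constant term in t, the y-derivative of each t-coefficient of D involves only
lower coefficients. By induction it vanishes, so the coefficient is a constant, and the value at y =
0 kills it. -/
theorem eq_zero_of_dy_eq_mul {k D : PowerSeries (Polynomial ℚ)} (hk : coeff 0 k = 0)
    (hD : dy D = k * D) (h0 : ev 0 D = 0) : D = 0 := by
  ext1 r
  rw [map_zero]
  induction r using Nat.strong_induction_on with
  | _ r ih =>
    have h1 : Polynomial.derivative (coeff r D) = 0 := by
      rw [← coeff_dy, hD, coeff_mul]
      refine Finset.sum_eq_zero fun p hp => ?_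
      have hp := Finset.HasAntidiagonal.mem_antidiagonal.mp hp
      rcases Nat.eq_zero_or_pos p.1 with h | h
      · rw [h, hk, zero_mul]
      · rw [ih p.2 (by omega), mul_zero]
    have h2 : (coeff r D).eval 0 = 0 := by rw [← coeff_ev, h0, map_zero]
    rw [Polynomial.eq_C_of_natDegree_eq_zero
      (Polynomial.derivative_eq_zero.mp h1)] at h2 ⊢
    rw [Polynomial.eval_C] at h2
    rw [h2, map_zero]

/-- A solution of `P_y = Q_y P` is `exp Q`, hence it satisfies `P_t = Q_t P`. -/
theorem derivative_eq_mul_of_dy_eq_mul {P Q : PowerSeries (Polynomial ℚ)}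
    (hQ : coeff 0 (dy Q) = 0) (h : dy P = dy Q * P) (hP0 : ev 0 P = 1) (hQ0 : ev 0 Q = 0) :
    derivative (Polynomial ℚ) P = derivative (Polynomial ℚ) Q * P := by
  -- The difference D = P_t - Q_t P satisfies D_y = Q_y D and vanishes at y = 0, because P = 1 and Q
  -- = 0 there.
  rw [← sub_eq_zero]
  apply eq_zero_of_dy_eq_mul hQ
  · rw [map_sub, dy_mul, dy_derivative, dy_derivative, h, derivative_mul]
    ring
  · rw [map_sub, map_mul, ev_derivative, ev_derivative, hP0, hQ0]
    simp

theorem mapCoeff_X_mul {B : Type*} [CommRing B] [Algebra ℚ B] (φ : Polynomial ℚ →ₗ[ℚ] B)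
    (f : PowerSeries (Polynomial ℚ)) : mapCoeff φ (X * f) = X * mapCoeff φ f := by
  ext1 n
  rw [coeff_mapCoeff]
  cases n with
  | zero => simp
  | succ n => rw [coeff_succ_X_mul, coeff_succ_X_mul, coeff_mapCoeff]

theorem mapCoeff_derivative {B : Type*} [CommRing B] [Algebra ℚ B] (φ : Polynomial ℚ →ₗ[ℚ] B)
    (f : PowerSeries (Polynomial ℚ)) :
    mapCoeff φ (derivative (Polynomial ℚ) f) = derivative B (mapCoeff φ f) := by
  ext1 n
  rw [coeff_mapCoeff, coeff_derivative, coeff_derivative, coeff_mapCoeff]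
  have h : coeff (n + 1) f * ((n : Polynomial ℚ) + 1) = ((n : ℚ) + 1) • coeff (n + 1) f := by
    rw [Polynomial.smul_eq_C_mul]
    simp [mul_comm]
  rw [h, map_smul, Algebra.smul_def]
  simp [mul_comm]

/-! ### The exponential series and the exponent of the formal integral -/

/-- The variable of the coefficient ring. -/
def y : PowerSeries (Polynomial ℚ) := PowerSeries.C Polynomial.X

/-- The series `exp (t y)`. -/
def expTY : PowerSeries (Polynomial ℚ) := rescale Polynomial.X (PowerSeries.exp (Polynomial ℚ))

theorem coeff_expTY_pow (s r : ℕ) : coeff r (expTY ^ s) =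
    Polynomial.C ((s : ℚ) ^ r / r.factorial) * Polynomial.X ^ r := by
  rw [expTY, ← map_pow, exp_pow_eq_rescale_exp, coeff_rescale, coeff_rescale, coeff_exp,
    div_eq_mul_one_div (_ ^ r), Polynomial.C_mul, Polynomial.algebraMap_eq, Polynomial.C_pow,
    Polynomial.C_eq_natCast]
  ring

theorem coeff_expTY (r : ℕ) : coeff r expTY =
    Polynomial.C (1 / (r.factorial : ℚ)) * Polynomial.X ^ r := by
  simpa using coeff_expTY_pow 1 r

theorem dy_expTY : dy expTY = X * expTY := by
  ext1 n
  rw [coeff_dy, coeff_expTY]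
  cases n with
  | zero => simp
  | succ n =>
    rw [coeff_succ_X_mul, coeff_expTY, Polynomial.derivative_C_mul_X_pow]
    have : ((n.factorial : ℕ) : ℚ) ≠ 0 := by positivity
    congr 2
    rw [Nat.factorial_succ]
    push_cast
    field_simp

theorem dy_expTY_pow (s : ℕ) :
    dy (expTY ^ s) = (s : PowerSeries (Polynomial ℚ)) * X * expTY ^ s := by
  induction s with
  | zero => simp [dy_one]
  | succ s ih =>
    rw [pow_succ, dy_mul, ih, dy_expTY]
    push_cast
    ring

/-- The exponent `(exp (t y) - 1 - t y - t² y² / 2) / t²`. -/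
def potential : PowerSeries (Polynomial ℚ) :=
  PowerSeries.mk fun r => if r = 0 then 0 else
    Polynomial.C (1 / ((r + 2).factorial : ℚ)) * Polynomial.X ^ (r + 2)

theorem coeff_dy_potential (r : ℕ) : coeff r (dy potential) = if r = 0 then 0 else
    Polynomial.C (1 / ((r + 1).factorial : ℚ)) * Polynomial.X ^ (r + 1) := by
  rw [coeff_dy, potential, coeff_mk]
  split_ifs with h
  · simp
  · rw [Polynomial.derivative_C_mul_X_pow]
    have : (((r + 1).factorial : ℕ) : ℚ) ≠ 0 := by positivity
    congr 2
    rw [Nat.factorial_succ (r + 1)]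
    push_cast
    field_simp
    ring

theorem X_mul_dy_potential : X * dy potential = expTY - 1 - X * y := by
  ext1 r
  have h0 : constantCoeff expTY = 1 := by
    rw [← coeff_zero_eq_constantCoeff_apply, coeff_expTY]
    simp
  rcases r with _ | _ | r
  · simp [h0]
  · rw [coeff_succ_X_mul, coeff_dy_potential, map_sub, map_sub, coeff_expTY, coeff_succ_X_mul]
    simp [y, coeff_one]
  · rw [coeff_succ_X_mul, coeff_dy_potential, map_sub, map_sub, coeff_expTY, coeff_succ_X_mul]
    simp [y, coeff_one]

theorem X_sq_mul_potential : 2 * (X ^ 2 * potential) = 2 * (expTY - 1 - X * y) - X ^ 2 * y ^ 2 := by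
  have h2 : ∀ r (f : PowerSeries (Polynomial ℚ)), coeff r (2 * f) = 2 * coeff r f := by
    intro r f
    rw [two_mul, two_mul, map_add]
  have hy : y ^ 2 = PowerSeries.C (Polynomial.X ^ 2) := by rw [y, ← map_pow]
  ext1 r
  have h0 : constantCoeff expTY = 1 := by
    rw [← coeff_zero_eq_constantCoeff_apply, coeff_expTY]
    simp
  rcases r with _ | _ | r
  · simp [h0]
  · rw [h2, map_sub, h2, map_sub, map_sub, coeff_expTY, pow_two, mul_assoc, mul_assoc,
      coeff_succ_X_mul, coeff_succ_X_mul, coeff_succ_X_mul]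
    simp [y, coeff_one]
  · rw [h2, map_sub, h2, map_sub, map_sub, coeff_expTY, pow_two X, mul_assoc, mul_assoc,
      coeff_succ_X_mul, coeff_succ_X_mul, coeff_succ_X_mul, coeff_succ_X_mul, coeff_succ_X_mul,
      potential, coeff_mk, y, ← map_pow, coeff_C, coeff_C, coeff_one]
    rcases r with _ | r
    · have : (2 : Polynomial ℚ) * Polynomial.C (1 / 2) = 1 := by
        rw [← Polynomial.C_ofNat, ← Polynomial.C_mul]
        norm_num
      simp [← mul_assoc] at this ⊢
      simp [this]
    · simp

theorem X_cube_mul_derivative_potential :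
    X ^ 3 * derivative (Polynomial ℚ) potential =
      X * (y * (expTY - 1)) - 2 * (expTY - 1 - X * y) := by
  have hE : X * derivative (Polynomial ℚ) expTY = X * (y * expTY) := by
    ext1 r
    rcases r with _ | r
    · simp
    · rw [coeff_succ_X_mul, coeff_succ_X_mul, coeff_derivative, y, coeff_C_mul, coeff_expTY,
        coeff_expTY]
      have : Polynomial.C (1 / ((r + 1).factorial : ℚ)) * ((r : Polynomial ℚ) + 1)
          = Polynomial.C (1 / (r.factorial : ℚ)) := by
        have h : ((r : Polynomial ℚ) + 1) = Polynomial.C ((r : ℚ) + 1) := by simp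
        have : ((r.factorial : ℕ) : ℚ) ≠ 0 := by positivity
        rw [h, ← Polynomial.C_mul]
        congr 1
        rw [Nat.factorial_succ]
        push_cast
        field_simp
      rw [mul_right_comm, this]
      ring
  have hy : derivative (Polynomial ℚ) y = 0 := derivative_C
  -- Apply t ∂/∂t to the formula for 2t² times the potential; the factor 2 avoids the fraction 1/2
  -- and is cancelled at the end.
  have h := congrArg (fun f => X * derivative (Polynomial ℚ) f) X_sq_mul_potential
  have hd2 : derivative (Polynomial ℚ) (2 : PowerSeries (Polynomial ℚ)) = 0 := derivative_ofNat 2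
  simp only [derivative_mul, derivative_sub, hy, hd2, pow_two, derivative_X,
    derivative_one] at h
  have hX := X_sq_mul_potential
  have h2ne : (2 : PowerSeries (Polynomial ℚ)) ≠ 0 := by
    intro h
    have := congrArg (fun f => (coeff 0 f).eval 0) h
    rw [← map_ofNat (PowerSeries.C (R := Polynomial ℚ)) 2] at this
    simp at this
  apply mul_left_cancel₀ h2ne
  linear_combination h - 2 * hX + 2 * hE

/-! ### Integration by parts and the Gamma-type recursion -/

variable {L : Polynomial ℚ →ₗ[ℚ] ℚ}

theorem mapCoeff_y_mul (hL : ∀ p, L (Polynomial.X * p) = -L (Polynomial.derivative p))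
    (f : PowerSeries (Polynomial ℚ)) :
    mapCoeff L (y * f) = -mapCoeff L (dy f) := by
  ext1 n
  rw [map_neg, coeff_mapCoeff, coeff_mapCoeff, coeff_dy, y, coeff_C_mul, hL]

/-- Integration by parts. -/
theorem mapCoeff_integration_by_parts
    (hL : ∀ p, L (Polynomial.X * p) = -L (Polynomial.derivative p))
    {P : PowerSeries (Polynomial ℚ)} (hP : dy P = dy potential * P)
    (f : PowerSeries (Polynomial ℚ)) :
    X * mapCoeff L (dy f * P) + mapCoeff L (f * (expTY - 1) * P) = 0 := by
  have h := congrArg (fun g => X * g) (mapCoeff_y_mul hL (f * P))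
  simp only [mul_neg, ← mapCoeff_X_mul, dy_mul, hP] at h
  -- The summand -ty of t times the y-derivative of the potential cancels the Gaussian factor ty,
  -- and e^(ty) - 1 remains.
  have e : X * (dy f * P) + f * (expTY - 1) * P =
      X * (dy f * P + f * (dy potential * P)) + X * (y * (f * P)) := by
    linear_combination (-f * P) * X_mul_dy_potential
  rw [← mapCoeff_X_mul, ← map_add, e, map_add, h, add_neg_cancel]

theorem mapCoeff_two_mul {B : Type*} [CommRing B] [Algebra ℚ B] (φ : Polynomial ℚ →ₗ[ℚ] B)
    (f : PowerSeries (Polynomial ℚ)) : mapCoeff φ (2 * f) = 2 * mapCoeff φ f := by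
  rw [two_mul, two_mul, map_add]

/-- Integration by parts with f = e^(sty), whose y-derivative is s t f. This is the functional
equation of the Gamma function in formal guise. -/
theorem mapCoeff_expTY_pow_succ
    (hL : ∀ p, L (Polynomial.X * p) = -L (Polynomial.derivative p))
    {P : PowerSeries (Polynomial ℚ)} (hP : dy P = dy potential * P) (s : ℕ) :
    mapCoeff L (expTY ^ (s + 1) * P) =
      (1 - (s : PowerSeries ℚ) * X ^ 2) * mapCoeff L (expTY ^ s * P) := by
  have h := mapCoeff_integration_by_parts hL hP (expTY ^ s)
  have h1 : dy (expTY ^ s) * P = X * ((s : PowerSeries (Polynomial ℚ)) * (expTY ^ s * P)) := by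
    rw [dy_expTY_pow]
    ring
  have h2 : mapCoeff L ((s : PowerSeries (Polynomial ℚ)) * (expTY ^ s * P)) =
      (s : PowerSeries ℚ) * mapCoeff L (expTY ^ s * P) := by
    rw [← nsmul_eq_mul, map_nsmul, nsmul_eq_mul]
  have h3 : expTY ^ s * (expTY - 1) * P = expTY ^ (s + 1) * P - expTY ^ s * P := by ring
  rw [h1, h3, mapCoeff_X_mul, h2, map_sub] at h
  linear_combination h

/-- The series `∑ iᵏ t²ᵏ`, summed over `k ≥ 1`. -/
def geom (i : ℕ) : PowerSeries ℚ :=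
  PowerSeries.mk fun r => if Even r ∧ r ≠ 0 then (i : ℚ) ^ (r / 2) else 0

theorem one_sub_mul_geom (i : ℕ) :
    (1 - (i : PowerSeries ℚ) * X ^ 2) * geom i = (i : PowerSeries ℚ) * X ^ 2 := by
  have hi : (i : PowerSeries ℚ) = PowerSeries.C (i : ℚ) := by simp
  ext1 r
  rw [sub_mul, one_mul, map_sub, mul_assoc, hi, coeff_C_mul, coeff_C_mul, coeff_X_pow_mul',
    coeff_X_pow]
  rcases r with _ | _ | r
  · simp [geom]
  · simp [geom]
  · have : (r + 1 + 1) / 2 = r / 2 + 1 := by omega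
    by_cases hr : Even r
    · rcases Nat.eq_zero_or_pos r with h | h
      · subst h
        simp [geom]
      · have h' : r ≠ 0 := by omega
        simp [geom, hr, h', this, pow_succ, mul_comm]
    · have h' : r ≠ 0 := by
        rintro rfl
        exact hr Even.zero
      simp [geom, Nat.even_add_one, hr, h']

/-- For natural `s`, the logarithmic derivative of `L (exp (s t y) P)`. -/
theorem derivative_mapCoeff_expTY_pow
    (hL : ∀ p, L (Polynomial.X * p) = -L (Polynomial.derivative p))
    {P : PowerSeries (Polynomial ℚ)} (hP : dy P = dy potential * P) (s : ℕ) :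
    X * derivative ℚ (mapCoeff L (expTY ^ s * P)) * mapCoeff L P =
      (X * derivative ℚ (mapCoeff L P) - 2 * (∑ i ∈ Finset.range s, geom i) * mapCoeff L P) *
        mapCoeff L (expTY ^ s * P) := by
  induction s with
  | zero => simp
  | succ s ih =>
    have hs : derivative ℚ (s : PowerSeries ℚ) = 0 := Derivation.map_natCast _ _
    -- The new factor 1 - s t² adds -2 s t²/(1 - s t²), that is -2 `geom s`, to the logarithmic
    -- derivative t ∂/∂t.
    rw [mapCoeff_expTY_pow_succ hL hP, derivative_mul, derivative_sub, derivative_mul, hs,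
      pow_two, derivative_mul, derivative_X, derivative_one, Finset.sum_range_succ]
    have hg := one_sub_mul_geom s
    linear_combination (1 - (s : PowerSeries ℚ) * X ^ 2) * ih +
      (2 * mapCoeff L P * mapCoeff L (expTY ^ s * P)) * hg

/-! ### Interpolation in s and the Bernoulli numbers -/

/-- The power sum polynomial. -/
def faulhaber (k : ℕ) : Polynomial ℚ :=
  ∑ i ∈ Finset.range (k + 1),
    Polynomial.C (bernoulli i * (k + 1).choose i / (k + 1)) * Polynomial.X ^ (k + 1 - i)

theorem eval_faulhaber (k s : ℕ) :
    (faulhaber k).eval (s : ℚ) = ∑ i ∈ Finset.range s, (i : ℚ) ^ k := by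
  rw [sum_range_pow, faulhaber, Polynomial.eval_finsetSum]
  refine Finset.sum_congr rfl fun i _ => ?_
  simp only [Polynomial.eval_mul, Polynomial.eval_C, Polynomial.eval_pow, Polynomial.eval_X]
  ring

/-- Only the summand i = k is linear in the variable; its coefficient is B_k (k + 1)/(k + 1). -/
theorem eval_derivative_faulhaber (k : ℕ) :
    (Polynomial.derivative (faulhaber k)).eval 0 = bernoulli k := by
  rw [← Polynomial.coeff_zero_eq_eval_zero, Polynomial.coeff_derivative, faulhaber,
    Polynomial.finsetSum_coeff, Finset.sum_range_succ, Finset.sum_eq_zero]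
  · have h : (k : ℚ) + 1 ≠ 0 := by positivity
    simp [h]
  · intro i hi
    rw [Finset.mem_range] at hi
    rw [Polynomial.coeff_C_mul, Polynomial.coeff_X_pow, if_neg (by omega), mul_zero]

/-- The sum of the series `geom i` for `i < s`, with the number `s` as a variable. -/
def geomSum : PowerSeries (Polynomial ℚ) :=
  PowerSeries.mk fun r => if Even r ∧ r ≠ 0 then faulhaber (r / 2) else 0

theorem ev_geomSum (s : ℕ) : ev s geomSum = ∑ i ∈ Finset.range s, geom i := by
  ext1 r
  rw [coeff_ev, geomSum, coeff_mk, map_sum]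
  simp only [geom, coeff_mk]
  split_ifs with h
  · exact eval_faulhaber _ _
  · simp

/-- The series `L (exp (s t y) P)`, with the number `s` as a variable. -/
def moment (L : Polynomial ℚ →ₗ[ℚ] ℚ) (P : PowerSeries (Polynomial ℚ)) :
    PowerSeries (Polynomial ℚ) :=
  PowerSeries.mk fun r => ∑ p ∈ Finset.HasAntidiagonal.antidiagonal r,
    Polynomial.C (L (Polynomial.X ^ p.1 * coeff p.2 P) / p.1.factorial) * Polynomial.X ^ p.1

theorem ev_moment (L : Polynomial ℚ →ₗ[ℚ] ℚ) (P : PowerSeries (Polynomial ℚ)) (s : ℕ) :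
    ev s (moment L P) = mapCoeff L (expTY ^ s * P) := by
  ext1 r
  rw [coeff_ev, moment, coeff_mk, coeff_mapCoeff, coeff_mul, map_sum, Polynomial.eval_finsetSum]
  refine Finset.sum_congr rfl fun p _ => ?_
  have e : ∀ (a : ℚ) (q : Polynomial ℚ), L (Polynomial.C a * q) = a * L q := by
    intro a q
    rw [← Polynomial.smul_eq_C_mul, map_smul, smul_eq_mul]
  rw [coeff_expTY_pow, mul_assoc, e, Polynomial.eval_mul, Polynomial.eval_C,
    Polynomial.eval_pow, Polynomial.eval_X]
  ring

theorem ev_dy_moment (L : Polynomial ℚ →ₗ[ℚ] ℚ) (P : PowerSeries (Polynomial ℚ)) :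
    ev 0 (dy (moment L P)) = X * mapCoeff L (y * P) := by
  ext1 r
  rw [coeff_ev, coeff_dy, moment, coeff_mk, ← Polynomial.coeff_zero_eq_eval_zero,
    Polynomial.coeff_derivative, Polynomial.finsetSum_coeff]
  simp only [Polynomial.coeff_C_mul, Polynomial.coeff_X_pow]
  cases r with
  | zero => simp
  | succ r =>
    rw [coeff_succ_X_mul, coeff_mapCoeff, y, coeff_C_mul, Finset.sum_eq_single (1, r)]
    · simp
    · intro p hp hne
      have hp := Finset.HasAntidiagonal.mem_antidiagonal.mp hp
      rw [if_neg, mul_zero]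
      intro h
      apply hne
      ext <;> simp <;> omega
    · intro h
      exact absurd (Finset.HasAntidiagonal.mem_antidiagonal.mpr (by omega)) h

/-- Each coefficient is a polynomial, determined by its values at the infinitely many natural
numbers. This is what allows differentiation in s. -/
theorem eq_of_ev_natCast_eq {f g : PowerSeries (Polynomial ℚ)} (h : ∀ s : ℕ, ev s f = ev s g) :
    f = g := by
  ext1 r
  apply Polynomial.eq_of_infinite_eval_eq
  refine Set.Infinite.mono ?_ (Set.infinite_range_of_injective (Nat.cast_injective (R := ℚ)))
  rintro _ ⟨s, rfl⟩
  rw [Set.mem_ofPred_eq, ← coeff_ev, ← coeff_ev, h]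

/-- A power series with constant coefficients. -/
def const : PowerSeries ℚ →+* PowerSeries (Polynomial ℚ) := PowerSeries.map Polynomial.C

theorem ev_const (a : ℚ) (f : PowerSeries ℚ) : ev a (const f) = f := by
  ext1 r
  rw [coeff_ev, const, coeff_map, Polynomial.eval_C]

theorem dy_const (f : PowerSeries ℚ) : dy (const f) = 0 := by
  ext1 r
  rw [coeff_dy, const, coeff_map, Polynomial.derivative_C, map_zero]

/-- The s-derivative at s = 0 of the logarithmic derivative formula for L(e^(sty) P), cleared of
denominators. -/
theorem derivative_mapCoeff_y_mul
    (hL : ∀ p, L (Polynomial.X * p) = -L (Polynomial.derivative p))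
    {P : PowerSeries (Polynomial ℚ)} (hP : dy P = dy potential * P) :
    X * derivative ℚ (X * mapCoeff L (y * P)) * mapCoeff L P =
      X * derivative ℚ (mapCoeff L P) * (X * mapCoeff L (y * P)) -
        2 * ev 0 (dy geomSum) * mapCoeff L P ^ 2 := by
  -- In this identity the variable of the coefficient polynomials is s, not y; accordingly `dy` and
  -- `ev 0` below are the derivative in s and the value at s = 0.
  have h : X * derivative (Polynomial ℚ) (moment L P) * const (mapCoeff L P) =
      (const (X * derivative ℚ (mapCoeff L P)) - 2 * geomSum * const (mapCoeff L P)) *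
        moment L P := by
    apply eq_of_ev_natCast_eq
    intro s
    have hX : ev s X = X := by simp [ev]
    have h2 : ev s 2 = 2 := map_ofNat _ _
    simp only [map_mul, map_sub, ev_const, ev_derivative, ev_moment, ev_geomSum, hX, h2]
    exact derivative_mapCoeff_expTY_pow hL hP s
  have h' := congrArg (fun f => ev 0 (dy f)) h
  have hX : ev 0 X = X := by simp [ev]
  have hdX : dy X = 0 := by
    ext1 r
    rw [coeff_dy, coeff_X]
    split_ifs <;> simp
  have h2 : ev 0 2 = 2 := map_ofNat _ _
  have hd2 : dy 2 = 0 := by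
    rw [← one_add_one_eq_two, map_add, dy_one, add_zero]
  have hm : ev 0 (moment L P) = mapCoeff L P := by
    simpa using ev_moment L P 0
  have hg : ev 0 geomSum = 0 := by
    simpa using ev_geomSum 0
  simp only [dy_mul, map_sub, map_add, map_mul, dy_const, ev_const, hX, hdX, h2, hd2, map_zero,
    dy_derivative, ev_derivative, ev_dy_moment, hm, hg] at h'
  linear_combination h'

theorem coeff_ev_dy_geomSum (k : ℕ) (hk : k ≠ 0) :
    coeff (2 * k) (ev 0 (dy geomSum)) = bernoulli k := by
  rw [coeff_ev, coeff_dy, geomSum, coeff_mk, if_pos ⟨even_two_mul k, by omega⟩,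
    Nat.mul_div_cancel_left _ two_pos, eval_derivative_faulhaber]

/-- Apply L to t³ P_t, with P_t = Q_t P for Q the potential, and remove the terms containing e^(ty)
- 1 by integrating by parts with f = 1 and f = y. -/
theorem X_cube_mul_derivative_mapCoeff
    (hL : ∀ p, L (Polynomial.X * p) = -L (Polynomial.derivative p))
    {P : PowerSeries (Polynomial ℚ)} (hP : dy P = dy potential * P) (hP0 : ev 0 P = 1) :
    X ^ 3 * derivative ℚ (mapCoeff L P) =
      2 * (X * mapCoeff L (y * P)) - X ^ 2 * mapCoeff L P := by
  have hdt := derivative_eq_mul_of_dy_eq_mul (by rw [coeff_dy_potential, if_pos rfl])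
    hP hP0
    (by
      ext1 r
      rw [coeff_ev, potential, coeff_mk]
      split_ifs <;> simp)
  have h1 := mapCoeff_integration_by_parts hL hP 1
  have hy := mapCoeff_integration_by_parts hL hP y
  have hdy : dy y = 1 := by
    ext1 r
    rw [coeff_dy, y, coeff_C, coeff_one]
    split_ifs <;> simp
  rw [dy_one, zero_mul, map_zero, mul_zero, zero_add, one_mul] at h1
  rw [hdy, one_mul] at hy
  have h3 : X ^ 3 * derivative (Polynomial ℚ) P =
      X * (y * (expTY - 1) * P) - 2 * ((expTY - 1) * P) + 2 * (X * (y * P)) := by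
    rw [hdt]
    linear_combination P * X_cube_mul_derivative_potential
  have h4 := congrArg (mapCoeff L) h3
  have h5 : (X : PowerSeries (Polynomial ℚ)) ^ 3 * derivative (Polynomial ℚ) P =
      X * (X * (X * derivative (Polynomial ℚ) P)) := by ring
  rw [map_add, map_sub, mapCoeff_two_mul, mapCoeff_two_mul, h1, mapCoeff_X_mul, mapCoeff_X_mul,
    h5, mapCoeff_X_mul, mapCoeff_X_mul, mapCoeff_X_mul, mapCoeff_derivative] at h4
  linear_combination h4 + X * hy

/-- The Stirling series: the logarithm of the formal integral of `exp ((exp x - 1 - x) / ħ)`,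
where `ħ = t²`. -/
theorem coeff_log_formal_integral
    (hL : ∀ p, L (Polynomial.X * p) = -L (Polynomial.derivative p)) (hL1 : L 1 = 1)
    {P : PowerSeries (Polynomial ℚ)} (hP : dy P = dy potential * P) (hP0 : ev 0 P = 1)
    {F : PowerSeries ℚ} (hF : derivative ℚ (mapCoeff L P) = derivative ℚ F * mapCoeff L P)
    {n : ℕ} (hn : n ≠ 0) :
    coeff (2 * n) F = -(bernoulli (n + 1) / ((n : ℚ) * ((n : ℚ) + 1))) := by
  have h1 := X_cube_mul_derivative_mapCoeff hL hP hP0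
  have h2 := derivative_mapCoeff_y_mul hL hP
  set Z := mapCoeff L P with hZ
  set U := X * mapCoeff L (y * P) with hU
  have hZ0 : Z ≠ 0 := by
    -- Modulo t the series P is 1, and L 1 = 1, so Z has constant term 1 and may be cancelled.
    intro h
    have hc : coeff 0 Z = 1 := by
      have h0 : Polynomial.derivative (coeff 0 P) = 0 := by
        rw [← coeff_dy, hP, coeff_mul, Finset.HasAntidiagonal.antidiagonal_zero, Finset.sum_singleton,
          coeff_dy_potential, if_pos rfl, zero_mul]
      have h00 : (coeff 0 P).eval 0 = 1 := by
        rw [← coeff_ev, hP0, coeff_one, if_pos rfl]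
      rw [Polynomial.eq_C_of_natDegree_eq_zero (Polynomial.derivative_eq_zero.mp h0),
        Polynomial.eval_C] at h00
      rw [hZ, coeff_mapCoeff,
        Polynomial.eq_C_of_natDegree_eq_zero (Polynomial.derivative_eq_zero.mp h0), h00,
        Polynomial.C_1, hL1]
    rw [h, map_zero] at hc
    exact zero_ne_one hc
  have hUV : 2 * U = Z * (X ^ 2 + X ^ 3 * derivative ℚ F) := by
    rw [hF] at h1
    linear_combination -h1
  clear_value U Z
  have hdUV := congrArg (derivative ℚ) hUV
  have hd2 : derivative ℚ (2 : PowerSeries ℚ) = 0 := derivative_ofNat 2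
  rw [derivative_mul, derivative_mul Z, hd2] at hdUV
  -- Both sides are -4 times the Bernoulli series: 2U/Z = t² + t³F' by `hUV`, and `h2` computes
  -- t(U/Z)'. Multiplying by Z² avoids the quotient.
  have hmain : X * derivative ℚ (X ^ 2 + X ^ 3 * derivative ℚ F) = -4 * ev 0 (dy geomSum) := by
    apply mul_left_cancel₀ (pow_ne_zero 2 hZ0)
    linear_combination (-X * Z) * hdUV + 2 * h2 + X * derivative ℚ Z * hUV
  -- In degree 2n + 2 the left side is (2n + 2)(2n) times the coefficient of t^(2n) in F, and the
  -- right side is -4 B_(n+1).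
  have hc := congrArg (coeff (2 * (n + 1))) hmain
  have h4 : (-4 : PowerSeries ℚ) = PowerSeries.C (-4) := by
    rw [map_neg, map_ofNat]
  have e1 : 2 * (n + 1) = 2 * n + 1 + 1 := by ring
  have e2 : 2 * n + 1 + 1 = (2 * n - 1) + 3 := by omega
  have e3 : 2 * n - 1 + 1 = 2 * n := by omega
  rw [h4, coeff_C_mul, coeff_ev_dy_geomSum _ n.succ_ne_zero, e1, coeff_succ_X_mul,
    coeff_derivative, map_add, coeff_X_pow, if_neg (by omega), zero_add] at hc
  rw [e2, coeff_X_pow_mul, coeff_derivative, e3] at hc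
  have hn' : (n : ℚ) ≠ 0 := by exact_mod_cast hn
  have hn1 : (n : ℚ) + 1 ≠ 0 := by positivity
  rw [Nat.cast_sub (by omega)] at hc
  push_cast at hc
  rw [← neg_div, eq_div_iff (mul_ne_zero hn' hn1)]
  linear_combination hc / 4

end PolySeries

/-! ### Structures on a fixed set of half-edges -/

namespace HGraph

/-- The graph structures on a given set of half-edges. -/
abbrev Str (U : Type) : Type := {E : U → U // Function.Involutive E} × Setoid U

instance finite_setoid (U : Type) [Finite U] : Finite (Setoid U) :=
  Finite.of_injective (fun s : Setoid U => s.r) fun _ _ h => Setoid.ext fun a b => by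
    exact iff_of_eq (congrFun (congrFun h a) b)

instance fintypeStr (U : Type) [Finite U] : Fintype (Str U) := Fintype.ofFinite _

/-- The graph given by a structure on a finite set. -/
abbrev Str.graph {U : Type} [Finite U] (S : Str U) : HGraph where
  H := U
  finite_H := inferInstance
  E := S.1.1
  E_involutive := S.1.2
  V := S.2

/-- Transport of a structure along a bijection. -/
def Str.map {U U' : Type} (e : U ≃ U') (S : Str U) : Str U' :=
  ⟨⟨fun x => e (S.1.1 (e.symm x)), fun x => by
    dsimp only
    rw [Equiv.symm_apply_apply, S.1.2, Equiv.apply_symm_apply]⟩, S.2.comap e.symm⟩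

/-- Transport of structures as a bijection. -/
def Str.mapEquiv {U U' : Type} (e : U ≃ U') : Str U ≃ Str U' where
  toFun := Str.map e
  invFun := Str.map e.symm
  left_inv S := by
    refine Prod.ext (Subtype.ext (funext fun x => ?_)) (Setoid.ext fun a b => ?_)
    · simp [Str.map]
    · change S.2 (e.symm (e a)) (e.symm (e b)) ↔ _
      simp
  right_inv S := by
    refine Prod.ext (Subtype.ext (funext fun x => ?_)) (Setoid.ext fun a b => ?_)
    · simp [Str.map]
    · change S.2 (e (e.symm a)) (e (e.symm b)) ↔ _
      simp

/-- A bijection is an isomorphism onto the transported structure. -/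
def Str.mapIso {U U' : Type} [Finite U] [Finite U'] (e : U ≃ U') (S : Str U) :
    Iso S.graph (S.map e).graph where
  toEquiv := e
  map_E h := by
    change _ = e (S.1.1 (e.symm (e h)))
    rw [Equiv.symm_apply_apply]
  map_V h k := by
    change _ ↔ S.2 (e.symm (e h)) (e.symm (e k))
    rw [Equiv.symm_apply_apply, Equiv.symm_apply_apply]

/-- The disjoint union of two structures. -/
def Str.sum {A B : Type} (S : Str A) (T : Str B) : Str (A ⊕ B) :=
  ⟨⟨Sum.map S.1.1 T.1.1, fun x => by
    rcases x with x | x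
    · simp [S.1.2 x]
    · simp [T.1.2 x]⟩,
  { r := Sum.LiftRel S.2 T.2
    iseqv :=
      { refl := fun x => by
          rcases x with x | x
          · exact Sum.LiftRel.inl (S.2.refl' x)
          · exact Sum.LiftRel.inr (T.2.refl' x)
        symm := fun h => by
          rcases h with h | h
          · exact Sum.LiftRel.inl (S.2.symm' h)
          · exact Sum.LiftRel.inr (T.2.symm' h)
        trans := fun h h' => by
          rcases h with h | h
          · rcases h' with h' | h'
            exact Sum.LiftRel.inl (S.2.trans' h h')
          · rcases h' with _ | h'
            exact Sum.LiftRel.inr (T.2.trans' h h') } }⟩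

theorem Str.sum_V_inl {A B : Type} (S : Str A) (T : Str B) (a a' : A) :
    (S.sum T).2 (Sum.inl a) (Sum.inl a') ↔ S.2 a a' := Sum.liftRel_inl_inl

theorem Str.sum_V_inr {A B : Type} (S : Str A) (T : Str B) (b b' : B) :
    (S.sum T).2 (Sum.inr b) (Sum.inr b') ↔ T.2 b b' := Sum.liftRel_inr_inr

theorem Str.sum_V_inl_inr {A B : Type} (S : Str A) (T : Str B) (a : A) (b : B) :
    ¬ (S.sum T).2 (Sum.inl a) (Sum.inr b) := Sum.not_liftRel_inl_inr

theorem Str.sum_V_inr_inl {A B : Type} (S : Str A) (T : Str B) (a : A) (b : B) :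
    ¬ (S.sum T).2 (Sum.inr b) (Sum.inl a) := Sum.not_liftRel_inr_inl

theorem Str.sum_injective {A B : Type} {S S' : Str A} {T T' : Str B}
    (h : S.sum T = S'.sum T') : S = S' ∧ T = T' := by
  have h1 : ∀ x, (S.sum T).1.1 x = (S'.sum T').1.1 x := fun x => by rw [h]
  have h2 : ∀ x y, (S.sum T).2 x y ↔ (S'.sum T').2 x y := fun x y => by rw [h]
  refine ⟨Prod.ext (Subtype.ext (funext fun x => ?_)) (Setoid.ext fun a b => ?_),
    Prod.ext (Subtype.ext (funext fun x => ?_)) (Setoid.ext fun a b => ?_)⟩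
  · exact Sum.inl_injective (h1 (Sum.inl x))
  · rw [← S.sum_V_inl T, h2, Str.sum_V_inl]
  · exact Sum.inr_injective (h1 (Sum.inr x))
  · rw [← S.sum_V_inr T, h2, Str.sum_V_inr]

/-- Two half-edges are in the same component. -/
def Reach (G : HGraph) : G.H → G.H → Prop :=
  Relation.ReflTransGen fun a b => G.V a b ∨ b = G.E a

theorem Reach.symm {G : HGraph} {a b : G.H} (h : G.Reach a b) : G.Reach b a := by
  have : Std.Symm fun a b => G.V a b ∨ b = G.E a := ⟨?_⟩
  · exact Relation.ReflTransGen.stdSymm.symm _ _ h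
  rintro a b (h | rfl)
  · exact Or.inl (G.V.symm' h)
  · exact Or.inr (G.E_involutive a).symm

theorem Reach.map {G G' : HGraph} (f : Iso G G') {a b : G.H} (h : G.Reach a b) :
    G'.Reach (f.toEquiv a) (f.toEquiv b) := by
  refine Relation.ReflTransGen.lift f.toEquiv (fun a b => ?_) _ _ h
  rintro (h | rfl)
  · exact Or.inl ((f.map_V a b).mp h)
  · exact Or.inr (f.map_E a)

theorem reach_iff_of_iso {G G' : HGraph} (f : Iso G G') {a b : G.H} :
    G'.Reach (f.toEquiv a) (f.toEquiv b) ↔ G.Reach a b := by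
  refine ⟨fun h => ?_, Reach.map f⟩
  have := Reach.map f.symm h
  simpa [Iso.symm] using this

theorem connected_iff_of_iso {G G' : HGraph} (f : Iso G G') : G.Connected ↔ G'.Connected := by
  have key : ∀ {G G' : HGraph}, Iso G G' → G.Connected → G'.Connected := by
    intro G G' f h
    refine ⟨h.1.map f.toEquiv, fun a b => ?_⟩
    have := Reach.map f (h.2 (f.toEquiv.symm a) (f.toEquiv.symm b))
    rwa [Equiv.apply_symm_apply, Equiv.apply_symm_apply] at this
  exact ⟨key f, key f.symm⟩

theorem connected_iff_reach {G : HGraph} (a : G.H) : G.Connected ↔ ∀ b, G.Reach a b :=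
  ⟨fun h b => h.2 a b, fun h => ⟨⟨a⟩, fun b c => (h b).symm.trans (h c)⟩⟩

theorem Str.reach_sum_inl {A B : Type} [Finite A] [Finite B] (S : Str A) (T : Str B) (a : A)
    (x : A ⊕ B) :
    (S.sum T).graph.Reach (Sum.inl a) x ↔ ∃ a', x = Sum.inl a' ∧ S.graph.Reach a a' := by
  constructor
  · intro h
    induction h with
    | refl => exact ⟨a, rfl, Relation.ReflTransGen.refl⟩
    | @tail y z _ hyz ih =>
      obtain ⟨a', rfl, ha⟩ := ih
      rcases hyz with hyz | rfl
      · rcases z with z | z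
        · exact ⟨z, rfl, ha.tail (Or.inl ((S.sum_V_inl T _ _).mp hyz))⟩
        · exact absurd hyz (S.sum_V_inl_inr T _ _)
      · exact ⟨S.1.1 a', rfl, ha.tail (Or.inr rfl)⟩
  · rintro ⟨a', rfl, h⟩
    refine Relation.ReflTransGen.lift Sum.inl (fun b c => ?_) _ _ h
    rintro (h | rfl)
    · exact Or.inl ((S.sum_V_inl T _ _).mpr h)
    · exact Or.inr rfl

/-- A structure in which the left summand is closed is a disjoint union. -/
theorem Str.exists_eq_sum {A B : Type} (S : Str (A ⊕ B))
    (hE : ∀ x, (S.1.1 x).isLeft = x.isLeft) (hV : ∀ x y, S.2 x y → x.isLeft = y.isLeft) :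
    ∃ (S₁ : Str A) (S₂ : Str B), S₁.sum S₂ = S := by
  have h1 : ∀ a, ∃ a', S.1.1 (Sum.inl a) = Sum.inl a' := fun a =>
    Sum.isLeft_iff.mp (by rw [hE]; rfl)
  have h2 : ∀ b, ∃ b', S.1.1 (Sum.inr b) = Sum.inr b' := fun b =>
    Sum.isRight_iff.mp (by rw [← Sum.not_isLeft, hE]; simp)
  choose E₁ hE₁ using h1
  choose E₂ hE₂ using h2
  have i1 : Function.Involutive E₁ := fun a => by
    have := S.1.2 (Sum.inl a)
    rw [hE₁, hE₁] at this
    exact Sum.inl_injective this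
  have i2 : Function.Involutive E₂ := fun a => by
    have := S.1.2 (Sum.inr a)
    rw [hE₂, hE₂] at this
    exact Sum.inr_injective this
  refine ⟨⟨⟨E₁, i1⟩, S.2.comap Sum.inl⟩, ⟨⟨E₂, i2⟩, S.2.comap Sum.inr⟩,
    Prod.ext (Subtype.ext (funext fun x => ?_)) (Setoid.ext fun x y => ?_)⟩
  · rcases x with x | x
    · exact (hE₁ x).symm
    · exact (hE₂ x).symm
  · rcases x with x | x <;> rcases y with y | y
    · rw [Str.sum_V_inl]
      rfl
    · exact iff_of_false (Str.sum_V_inl_inr _ _ _ _) fun h => by simpa using hV _ _ h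
    · exact iff_of_false (Str.sum_V_inr_inl _ _ _ _) fun h => by simpa using hV _ _ h
    · rw [Str.sum_V_inr]
      rfl

/-! ### Weighted counts -/

/-- A weight of graphs that is invariant under isomorphisms and multiplicative on disjoint
unions. -/
structure IsMultiplicative {R : Type*} [CommRing R] (w : HGraph → R) : Prop where
  iso : ∀ {G G' : HGraph}, Iso G G' → w G = w G'
  sum : ∀ {A B : Type} [Finite A] [Finite B] (S : Str A) (T : Str B),
    w (S.sum T).graph = w S.graph * w T.graph

variable {R : Type*} [CommRing R]

/-- The weighted count of all structures on a set. -/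
def total (w : HGraph → R) (U : Type) [Finite U] : R := ∑ S : Str U, w S.graph

open Classical in
/-- The weighted count of the connected structures on a set. -/
def totalConn (w : HGraph → R) (U : Type) [Finite U] : R :=
  ∑ S : Str U with S.graph.Connected, w S.graph

theorem total_congr {w : HGraph → R} (hw : IsMultiplicative w) {U U' : Type} [Finite U]
    [Finite U'] (e : U ≃ U') : total w U = total w U' :=
  Fintype.sum_equiv (Str.mapEquiv e) _ _ fun S => hw.iso (S.mapIso e)

theorem totalConn_congr {w : HGraph → R} (hw : IsMultiplicative w) {U U' : Type} [Finite U]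
    [Finite U'] (e : U ≃ U') : totalConn w U = totalConn w U' := by
  classical
  refine Finset.sum_equiv (Str.mapEquiv e) (fun S => ?_) fun S _ => hw.iso (S.mapIso e)
  simp only [Finset.mem_filter, Finset.mem_univ, true_and]
  exact connected_iff_of_iso (S.mapIso e)

-- A structure in which the component of a is exactly A is the same as a connected structure on A
-- and an arbitrary structure on B.
open Classical in
theorem sum_component_eq {w : HGraph → R} (hw : IsMultiplicative w) {A B : Type} [Finite A]
    [Finite B] (a : A) :
    ∑ S : Str (A ⊕ B) with (∀ x, S.graph.Reach (Sum.inl a) x ↔ x.isLeft), w S.graph =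
      totalConn w A * total w B := by
  rw [totalConn, total, Finset.sum_mul_sum, ← Finset.sum_product']
  symm
  refine Finset.sum_nbij (fun p => p.1.sum p.2) ?_ ?_ ?_ ?_
  · intro p hp
    simp only [Finset.mem_product, Finset.mem_filter, Finset.mem_univ, true_and, and_true] at hp ⊢
    intro x
    rw [Str.reach_sum_inl]
    rcases x with x | x
    · exact iff_of_true ⟨x, rfl, hp.2 a x⟩ rfl
    · simp
  · intro p _ q _ h
    obtain ⟨h1, h2⟩ := Str.sum_injective h
    exact Prod.ext h1 h2
  · intro S hS
    simp only [Finset.coe_filter, Finset.mem_univ, true_and, Set.mem_ofPred_eq] at hS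
    obtain ⟨S₁, S₂, rfl⟩ := S.exists_eq_sum (fun x => by
        rw [Bool.eq_iff_iff, ← hS, ← hS]
        constructor
        · intro h
          have := h.tail (Or.inr rfl : _ ∨ _ = S.1.1 _)
          rwa [S.1.2] at this
        · intro h
          exact h.tail (Or.inr rfl)) (fun x y h => by
        rw [Bool.eq_iff_iff, ← hS, ← hS]
        exact ⟨fun h' => h'.tail (Or.inl h), fun h' => h'.tail (Or.inl (S.2.symm' h))⟩)
    refine ⟨(S₁, S₂), ?_, rfl⟩
    simp only [Finset.coe_product, Finset.coe_filter, Finset.mem_univ, true_and, Set.mem_prod,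
      Set.mem_ofPred_eq, Finset.coe_univ, Set.mem_univ, and_true]
    rw [connected_iff_reach (G := S₁.graph) a]
    intro b
    obtain ⟨b', hb, h⟩ := (Str.reach_sum_inl S₁ S₂ a (Sum.inl b)).mp ((hS _).mpr rfl)
    rw [Sum.inl_injective hb]
    exact h
  · intro p _
    exact (hw.sum p.1 p.2).symm

theorem total_option {w : HGraph → R} (hw : IsMultiplicative w) (W : Type) [Fintype W]
    [DecidableEq W] :
    total w (Option W) = ∑ T : Finset W, totalConn w {x // x ∈ Finset.insertNone T} *
      total w {x // x ∉ Finset.insertNone T} := by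
  classical
  -- Sort the structures by the set T of remaining points in the component of `none`.
  rw [total, ← Finset.sum_fiberwise Finset.univ
    (fun S : Str (Option W) => Finset.univ.filter fun x => S.graph.Reach none (some x))]
  refine Finset.sum_congr rfl fun T _ => ?_
  have hn : none ∈ Finset.insertNone T := Finset.none_mem_insertNone
  rw [← sum_component_eq hw ⟨none, hn⟩]
  let e : Option W ≃ {x // x ∈ Finset.insertNone T} ⊕ {x // x ∉ Finset.insertNone T} :=
    (Equiv.sumCompl _).symm
  have he : ∀ x, (e x).isLeft ↔ x ∈ Finset.insertNone T := by
    intro x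
    by_cases hx : x ∈ Finset.insertNone T
    · simp [e, Equiv.sumCompl_symm_apply_of_pos, hx]
    · simp [e, Equiv.sumCompl_symm_apply_of_neg, hx]
  have he0 : e none = Sum.inl ⟨none, hn⟩ := Equiv.sumCompl_symm_apply_of_pos hn
  refine Finset.sum_equiv (Str.mapEquiv e) (fun S => ?_) fun S _ => hw.iso (S.mapIso e)
  simp only [Finset.mem_filter, Finset.mem_univ, true_and]
  rw [← he0, Finset.ext_iff]
  have key : ∀ x, (Str.mapEquiv e S).graph.Reach (e none) (e x) ↔ S.graph.Reach none x :=
    fun x => reach_iff_of_iso (S.mapIso e)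
  constructor
  · intro h x
    obtain ⟨x, rfl⟩ := e.surjective x
    rw [key, he]
    cases x with
    | none => exact iff_of_true Relation.ReflTransGen.refl hn
    | some x => simpa using h x
  · intro h x
    have := h (e (some x))
    rw [key, he] at this
    simpa using this

/-- The recursive form of the exponential formula: j further points join the component of a marked
point, in N choose j ways. -/
theorem total_fin_succ {w : HGraph → R} (hw : IsMultiplicative w) (N : ℕ) :
    total w (Fin (N + 1)) = ∑ j ∈ Finset.range (N + 1),
      (N.choose j : R) * (totalConn w (Fin (j + 1)) * total w (Fin (N - j))) := by
  rw [total_congr hw (finSuccEquiv N), total_option hw]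
  have h := Finset.sum_powerset_apply_card
    (fun j => totalConn w (Fin (j + 1)) * total w (Fin (N - j))) (x := (Finset.univ : Finset (Fin N)))
  rw [Finset.card_univ, Fintype.card_fin, Finset.powerset_univ] at h
  simp only [nsmul_eq_mul] at h
  rw [← h]
  refine Finset.sum_congr rfl fun T _ => ?_
  rw [totalConn_congr hw (Fintype.equivFinOfCardEq (n := T.card + 1) (by
      rw [Fintype.card_coe, Finset.card_insertNone])),
    total_congr hw (Fintype.equivFinOfCardEq (n := N - T.card) (by
      rw [Fintype.card_subtype_compl, Fintype.card_coe, Finset.card_insertNone,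
        Fintype.card_option, Fintype.card_fin, Nat.add_sub_add_right]))]

end HGraph

/-! ### Counting vertices and edges -/

namespace HGraph

theorem three_mul_v_le {G : HGraph} (h : ∀ h : G.H, 3 ≤ {k : G.H | G.V h k}.ncard) :
    3 * G.v ≤ Nat.card G.H := by
  classical
  have hfin : Finite G.Vertex := inferInstanceAs (Finite (Quotient G.V))
  have := Fintype.ofFinite G.Vertex
  have hc : Nat.card G.H = ∑ q : G.Vertex, Nat.card {h : G.H // G.vert h = q} := by
    rw [← Nat.card_sigma]
    exact Nat.card_congr (Equiv.sigmaFiberEquiv G.vert).symm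
  rw [hc, v, Nat.card_eq_fintype_card, ← Finset.card_univ, mul_comm, ← smul_eq_mul]
  refine Finset.card_nsmul_le_sum _ _ _ fun q _ => ?_
  obtain ⟨a, rfl⟩ := Quotient.exists_rep q
  refine (h a).trans_eq ?_
  rw [← Nat.card_coe_set_eq]
  refine Nat.card_congr (Equiv.subtypeEquivRight fun k => ?_)
  change G.V a k ↔ Quotient.mk G.V k = Quotient.mk G.V a
  rw [Quotient.eq]
  exact ⟨fun h => G.V.symm' h, fun h => G.V.symm' h⟩

/-- Number the half-edges and take from each edge the half-edge with the smaller number. -/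
theorem exists_orientation {G : HGraph} (hE : ∀ h : G.H, G.E h ≠ h) :
    ∃ O : Set G.H, ∀ h, G.E h ∈ O ↔ h ∉ O := by
  obtain ⟨n, ⟨f⟩⟩ := Finite.exists_equiv_fin G.H
  refine ⟨{h | f h < f (G.E h)}, fun h => ?_⟩
  rw [Set.mem_ofPred_eq, Set.mem_ofPred_eq, G.E_involutive h, not_lt]
  exact ⟨le_of_lt, fun h' => lt_of_le_of_ne h' fun e => hE h (f.injective e)⟩

theorem ncard_orientation {G : HGraph} {O : Set G.H} (hO : ∀ h, G.E h ∈ O ↔ h ∉ O) :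
    O.ncard = G.e := by
  have hne : ∀ h : G.H, G.E h ≠ h := fun h e => by
    have := hO h
    rw [e] at this
    exact iff_not_self this
  refine Set.ncard_congr (fun h _ => {h, G.E h}) (fun h _ => ⟨h, hne h, rfl⟩) ?_ ?_
  · intro a b ha hb hab
    have : a ∈ ({b, G.E b} : Set G.H) := by
      rw [← hab]
      exact Set.mem_insert _ _
    rcases this with h | h
    · exact h
    · rw [Set.mem_singleton_iff] at h
      rw [h, hO] at ha
      exact absurd hb ha
  · rintro s ⟨h, -, rfl⟩
    by_cases hh : h ∈ O
    · exact ⟨h, hh, rfl⟩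
    · refine ⟨G.E h, (hO h).mpr hh, ?_⟩
      rw [G.E_involutive h, Set.pair_comm]

theorem two_mul_e {G : HGraph} (hE : ∀ h : G.H, G.E h ≠ h) : 2 * G.e = Nat.card G.H := by
  obtain ⟨O, hO⟩ := exists_orientation hE
  have h1 : Oᶜ = G.E '' O := by
    ext h
    rw [Set.mem_compl_iff, ← hO]
    exact ⟨fun hh => ⟨G.E h, hh, G.E_involutive h⟩, by
      rintro ⟨k, hk, rfl⟩
      rwa [G.E_involutive k]⟩
  rw [← Set.ncard_add_ncard_compl O, h1,
    Set.ncard_image_of_injective _ G.E_involutive.injective, ncard_orientation hO, two_mul]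

theorem card_eq_of_iso {G G' : HGraph} (f : Iso G G') : Nat.card G.H = Nat.card G'.H :=
  Nat.card_congr f.toEquiv

theorem v_eq_of_iso {G G' : HGraph} (f : Iso G G') : G.v = G'.v :=
  Nat.card_congr (Quotient.congr f.toEquiv f.map_V)

theorem noLeaf_of_iso {G G' : HGraph} (f : Iso G G') (h : ∀ h : G.H, G.E h ≠ h) :
    ∀ h : G'.H, G'.E h ≠ h := by
  intro x hx
  apply h (f.toEquiv.symm x)
  apply f.toEquiv.injective
  rw [f.map_E, Equiv.apply_symm_apply, hx]

theorem thick_of_iso {G G' : HGraph} (f : Iso G G')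
    (h : ∀ h : G.H, 3 ≤ {k : G.H | G.V h k}.ncard) :
    ∀ h : G'.H, 3 ≤ {k : G'.H | G'.V h k}.ncard := by
  intro x
  refine (h (f.toEquiv.symm x)).trans_eq ?_
  rw [← Nat.card_coe_set_eq, ← Nat.card_coe_set_eq]
  refine Nat.card_congr (f.toEquiv.subtypeEquiv fun k => ?_)
  change G.V _ _ ↔ G'.V _ _
  rw [f.map_V, Equiv.apply_symm_apply]

theorem v_sum {A B : Type} [Finite A] [Finite B] (S : Str A) (T : Str B) :
    (S.sum T).graph.v = S.graph.v + T.graph.v := by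
  have hA : Finite (Quotient S.2) := inferInstance
  have hB : Finite (Quotient T.2) := inferInstance
  change Nat.card (Quotient (S.sum T).2) = Nat.card (Quotient S.2) + Nat.card (Quotient T.2)
  rw [← Nat.card_sum]
  refine Nat.card_congr
    { toFun := Quotient.lift (Sum.map (Quotient.mk S.2) (Quotient.mk T.2)) ?_
      invFun := Sum.elim
        (Quotient.lift (fun a => Quotient.mk (S.sum T).2 (Sum.inl a)) fun a b h =>
          Quotient.sound (s := (S.sum T).2) ((S.sum_V_inl T a b).mpr h))
        (Quotient.lift (fun a => Quotient.mk (S.sum T).2 (Sum.inr a)) fun a b h =>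
          Quotient.sound (s := (S.sum T).2) ((S.sum_V_inr T a b).mpr h))
      left_inv := ?_
      right_inv := ?_ }
  · rintro a b (h | h)
    · exact congrArg Sum.inl (Quotient.sound h)
    · exact congrArg Sum.inr (Quotient.sound h)
  · intro q
    induction q using Quotient.inductionOn with
    | _ x => rcases x with x | x <;> rfl
  · rintro (q | q) <;> induction q using Quotient.inductionOn <;> rfl

theorem noLeaf_sum {A B : Type} [Finite A] [Finite B] (S : Str A) (T : Str B) :
    (∀ h, (S.sum T).graph.E h ≠ h) ↔ (∀ h, S.graph.E h ≠ h) ∧ ∀ h, T.graph.E h ≠ h := by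
  rw [Sum.forall]
  refine and_congr (forall_congr' fun a => not_congr ?_) (forall_congr' fun a => not_congr ?_)
  · exact Sum.inl_injective.eq_iff (a := S.1.1 a) (b := a)
  · exact Sum.inr_injective.eq_iff (a := T.1.1 a) (b := a)

theorem onlyLeaves_sum {A B : Type} [Finite A] [Finite B] (S : Str A) (T : Str B) :
    (∀ h, (S.sum T).graph.E h = h) ↔ (∀ h, S.graph.E h = h) ∧ ∀ h, T.graph.E h = h := by
  rw [Sum.forall]
  refine and_congr (forall_congr' fun a => ?_) (forall_congr' fun a => ?_)
  · exact Sum.inl_injective.eq_iff (a := S.1.1 a) (b := a)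
  · exact Sum.inr_injective.eq_iff (a := T.1.1 a) (b := a)

theorem discrete_sum {A B : Type} [Finite A] [Finite B] (S : Str A) (T : Str B) :
    (∀ h k, (S.sum T).graph.V h k → h = k) ↔
      (∀ h k, S.graph.V h k → h = k) ∧ ∀ h k, T.graph.V h k → h = k := by
  constructor
  · intro h
    exact ⟨fun a b hab => Sum.inl_injective (h _ _ ((S.sum_V_inl T a b).mpr hab)),
      fun a b hab => Sum.inr_injective (h _ _ ((S.sum_V_inr T a b).mpr hab))⟩
  · rintro ⟨h1, h2⟩ _ _ (h | h)
    · exact congrArg _ (h1 _ _ h)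
    · exact congrArg _ (h2 _ _ h)

theorem thick_sum {A B : Type} [Finite A] [Finite B] (S : Str A) (T : Str B) :
    (∀ h, 3 ≤ {k | (S.sum T).graph.V h k}.ncard) ↔
      (∀ h, 3 ≤ {k | S.graph.V h k}.ncard) ∧ ∀ h, 3 ≤ {k | T.graph.V h k}.ncard := by
  have h1 : ∀ a : A, {k | (S.sum T).2 (Sum.inl a) k} = Sum.inl '' {k | S.2 a k} := by
    intro a
    ext x
    rcases x with x | x
    · simp [S.sum_V_inl T]
    · simp [S.sum_V_inl_inr T]
  have h2 : ∀ a : B, {k | (S.sum T).2 (Sum.inr a) k} = Sum.inr '' {k | T.2 a k} := by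
    intro a
    ext x
    rcases x with x | x
    · simp [S.sum_V_inr_inl T]
    · simp [S.sum_V_inr T]
  rw [Sum.forall]
  refine and_congr (forall_congr' fun a => ?_) (forall_congr' fun a => ?_)
  · change 3 ≤ {k | (S.sum T).2 (Sum.inl a) k}.ncard ↔ _
    rw [h1, Set.ncard_image_of_injective _ Sum.inl_injective]
  · change 3 ≤ {k | (S.sum T).2 (Sum.inr a) k}.ncard ↔ _
    rw [h2, Set.ncard_image_of_injective _ Sum.inr_injective]

/-! ### The three weights -/

/-- The excess `|H| - 2 v`, which for graphs without leaves is `-2 χ`. -/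
def excess (G : HGraph) : ℕ := Nat.card G.H - 2 * G.v

/-- The lower bound on the block sizes ensures that the natural subtractions are not truncated. -/
theorem excess_sum {A B : Type} [Finite A] [Finite B] (S : Str A) (T : Str B)
    (hS : ∀ h, 3 ≤ {k | S.graph.V h k}.ncard) (hT : ∀ h, 3 ≤ {k | T.graph.V h k}.ncard) :
    (S.sum T).graph.excess = S.graph.excess + T.graph.excess := by
  have h1 := three_mul_v_le hS
  have h2 := three_mul_v_le hT
  have h3 : Nat.card (S.sum T).graph.H = Nat.card S.graph.H + Nat.card T.graph.H := Nat.card_sum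
  rw [excess, excess, excess, v_sum, h3]
  omega

open Classical in
/-- The weight of a graph with edges and vertices. -/
def graphWeight (G : HGraph) : PowerSeries ℚ :=
  if (∀ h : G.H, G.E h ≠ h) ∧ ∀ h : G.H, 3 ≤ {k : G.H | G.V h k}.ncard then
    (-1) ^ (Nat.card G.H / 2) * PowerSeries.X ^ G.excess else 0

open Classical in
/-- The weight of a collection of vertices without edges. -/
def vertexWeight (G : HGraph) : PowerSeries ℚ :=
  if (∀ h : G.H, G.E h = h) ∧ ∀ h : G.H, 3 ≤ {k : G.H | G.V h k}.ncard then
    PowerSeries.X ^ G.excess else 0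

open Classical in
/-- The weight of a perfect matching. -/
def matchingWeight (G : HGraph) : ℚ :=
  if (∀ h : G.H, G.E h ≠ h) ∧ ∀ h k : G.H, G.V h k → h = k then 1 else 0

theorem isMultiplicative_graphWeight : IsMultiplicative graphWeight where
  iso {G G'} f := by
    have : ((∀ h : G.H, G.E h ≠ h) ∧ ∀ h : G.H, 3 ≤ {k : G.H | G.V h k}.ncard) ↔
        ((∀ h : G'.H, G'.E h ≠ h) ∧ ∀ h : G'.H, 3 ≤ {k : G'.H | G'.V h k}.ncard) :=
      ⟨fun h => ⟨noLeaf_of_iso f h.1, thick_of_iso f h.2⟩,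
        fun h => ⟨noLeaf_of_iso f.symm h.1, thick_of_iso f.symm h.2⟩⟩
    rw [graphWeight, graphWeight, excess, excess, card_eq_of_iso f, v_eq_of_iso f]
    classical exact if_congr this rfl rfl
  sum {A B} _ _ S T := by
    rw [graphWeight, graphWeight, graphWeight, noLeaf_sum, thick_sum]
    by_cases h1 : (∀ h, S.graph.E h ≠ h) ∧ ∀ h, 3 ≤ {k | S.graph.V h k}.ncard
    · by_cases h2 : (∀ h, T.graph.E h ≠ h) ∧ ∀ h, 3 ≤ {k | T.graph.V h k}.ncard
      · have h3 : Nat.card (S.sum T).graph.H = Nat.card S.graph.H + Nat.card T.graph.H :=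
          Nat.card_sum
        have h4 := two_mul_e h1.1
        -- Halving is additive because the number of half-edges of S is even.
        have h5 : (Nat.card S.graph.H + Nat.card T.graph.H) / 2 =
            Nat.card S.graph.H / 2 + Nat.card T.graph.H / 2 := by omega
        rw [if_pos ⟨⟨h1.1, h2.1⟩, h1.2, h2.2⟩, if_pos h1, if_pos h2, h3, h5,
          excess_sum S T h1.2 h2.2, pow_add, pow_add]
        ring
      · rw [if_neg h2, mul_zero, if_neg fun h => h2 ⟨h.1.2, h.2.2⟩]
    · rw [if_neg h1, zero_mul, if_neg fun h => h1 ⟨h.1.1, h.2.1⟩]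

theorem onlyLeaves_of_iso {G G' : HGraph} (f : Iso G G') (h : ∀ h : G.H, G.E h = h) :
    ∀ h : G'.H, G'.E h = h := by
  intro x
  have := f.map_E (f.toEquiv.symm x)
  rwa [h, Equiv.apply_symm_apply, eq_comm] at this

theorem discrete_of_iso {G G' : HGraph} (f : Iso G G') (h : ∀ h k : G.H, G.V h k → h = k) :
    ∀ h k : G'.H, G'.V h k → h = k := by
  intro x z hxz
  have := h (f.toEquiv.symm x) (f.toEquiv.symm z)
  rw [f.map_V, Equiv.apply_symm_apply, Equiv.apply_symm_apply] at this
  exact f.toEquiv.symm.injective (this hxz)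

theorem isMultiplicative_vertexWeight : IsMultiplicative vertexWeight where
  iso {G G'} f := by
    have : ((∀ h : G.H, G.E h = h) ∧ ∀ h : G.H, 3 ≤ {k : G.H | G.V h k}.ncard) ↔
        ((∀ h : G'.H, G'.E h = h) ∧ ∀ h : G'.H, 3 ≤ {k : G'.H | G'.V h k}.ncard) :=
      ⟨fun h => ⟨onlyLeaves_of_iso f h.1, thick_of_iso f h.2⟩,
        fun h => ⟨onlyLeaves_of_iso f.symm h.1, thick_of_iso f.symm h.2⟩⟩
    rw [vertexWeight, vertexWeight, excess, excess, card_eq_of_iso f, v_eq_of_iso f]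
    classical exact if_congr this rfl rfl
  sum {A B} _ _ S T := by
    rw [vertexWeight, vertexWeight, vertexWeight, onlyLeaves_sum, thick_sum]
    by_cases h1 : (∀ h, S.graph.E h = h) ∧ ∀ h, 3 ≤ {k | S.graph.V h k}.ncard
    · by_cases h2 : (∀ h, T.graph.E h = h) ∧ ∀ h, 3 ≤ {k | T.graph.V h k}.ncard
      · rw [if_pos ⟨⟨h1.1, h2.1⟩, h1.2, h2.2⟩, if_pos h1, if_pos h2,
          excess_sum S T h1.2 h2.2, pow_add]
      · rw [if_neg h2, mul_zero, if_neg fun h => h2 ⟨h.1.2, h.2.2⟩]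
    · rw [if_neg h1, zero_mul, if_neg fun h => h1 ⟨h.1.1, h.2.1⟩]

theorem isMultiplicative_matchingWeight : IsMultiplicative matchingWeight where
  iso {G G'} f := by
    have : ((∀ h : G.H, G.E h ≠ h) ∧ ∀ h k : G.H, G.V h k → h = k) ↔
        ((∀ h : G'.H, G'.E h ≠ h) ∧ ∀ h k : G'.H, G'.V h k → h = k) :=
      ⟨fun h => ⟨noLeaf_of_iso f h.1, discrete_of_iso f h.2⟩,
        fun h => ⟨noLeaf_of_iso f.symm h.1, discrete_of_iso f.symm h.2⟩⟩
    classical exact if_congr this rfl rfl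
  sum {A B} _ _ S T := by
    rw [matchingWeight, matchingWeight, matchingWeight, noLeaf_sum, discrete_sum]
    by_cases h1 : (∀ h, S.graph.E h ≠ h) ∧ ∀ h k, S.graph.V h k → h = k
    · by_cases h2 : (∀ h, T.graph.E h ≠ h) ∧ ∀ h k, T.graph.V h k → h = k
      · rw [if_pos ⟨⟨h1.1, h2.1⟩, h1.2, h2.2⟩, if_pos h1, if_pos h2, one_mul]
      · rw [if_neg h2, mul_zero, if_neg fun h => h2 ⟨h.1.2, h.2.2⟩]
    · rw [if_neg h1, zero_mul, if_neg fun h => h1 ⟨h.1.1, h.2.1⟩]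

/-- A graph is an involution together with a partition. -/
theorem total_graphWeight (N : ℕ) : total graphWeight (Fin N) =
    PowerSeries.C ((-1) ^ (N / 2) * total matchingWeight (Fin N)) * total vertexWeight (Fin N) := by
  classical
  have hN : Nat.card (Fin N) = N := by simp
  let a : {E : Fin N → Fin N // Function.Involutive E} → ℚ := fun E =>
    if ∀ h, E.1 h ≠ h then 1 else 0
  let a' : {E : Fin N → Fin N // Function.Involutive E} → PowerSeries ℚ := fun E =>
    if ∀ h, E.1 h = h then 1 else 0
  let b : Setoid (Fin N) → PowerSeries ℚ := fun V =>
    if ∀ h, 3 ≤ {k | V h k}.ncard then PowerSeries.X ^ (N - 2 * Nat.card (Quotient V)) else 0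
  let b' : Setoid (Fin N) → ℚ := fun V => if ∀ h k, V h k → h = k then 1 else 0
  have h1 : total graphWeight (Fin N) =
      ∑ p : Str (Fin N), PowerSeries.C ((-1) ^ (N / 2) * a p.1) * b p.2 := by
    refine Finset.sum_congr rfl fun p _ => ?_
    have : p.graph.excess = N - 2 * Nat.card (Quotient p.2) := by
      rw [excess, v]
      exact congrArg (· - _) hN
    rw [graphWeight, this]
    by_cases h1 : ∀ h, p.1.1 h ≠ h
    · by_cases h2 : ∀ h, 3 ≤ {k | p.2 h k}.ncard
      · refine (if_pos ⟨h1, h2⟩).trans ?_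
        simp only [a, b, if_pos h1, if_pos h2]
        rw [hN, mul_one, map_pow, map_neg, map_one]
      · refine (if_neg fun h : _ ∧ _ => h2 h.2).trans ?_
        simp only [b, if_neg h2, mul_zero]
    · refine (if_neg fun h : _ ∧ _ => h1 h.1).trans ?_
      simp only [a, if_neg h1, mul_zero, map_zero, zero_mul]
  have h2 : total vertexWeight (Fin N) = ∑ p : Str (Fin N), a' p.1 * b p.2 := by
    refine Finset.sum_congr rfl fun p _ => ?_
    have : p.graph.excess = N - 2 * Nat.card (Quotient p.2) := by
      rw [excess, v]
      exact congrArg (· - _) hN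
    rw [vertexWeight, this]
    by_cases h1 : ∀ h, p.1.1 h = h
    · by_cases h2 : ∀ h, 3 ≤ {k | p.2 h k}.ncard
      · refine (if_pos ⟨h1, h2⟩).trans ?_
        simp only [a', b, if_pos h1, if_pos h2, one_mul]
      · refine (if_neg fun h : _ ∧ _ => h2 h.2).trans ?_
        simp only [b, if_neg h2, mul_zero]
    · refine (if_neg fun h : _ ∧ _ => h1 h.1).trans ?_
      simp only [a', if_neg h1, zero_mul]
  have h3 : total matchingWeight (Fin N) = ∑ p : Str (Fin N), a p.1 * b' p.2 := by
    refine Finset.sum_congr rfl fun p _ => ?_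
    by_cases h1 : ∀ h, p.1.1 h ≠ h
    · by_cases h2 : ∀ h k, p.2 h k → h = k
      · refine (if_pos ⟨h1, h2⟩).trans ?_
        simp only [a, b', if_pos h1, if_pos h2, one_mul]
      · refine (if_neg fun h : _ ∧ _ => h2 h.2).trans ?_
        simp only [b', if_neg h2, mul_zero]
    · refine (if_neg fun h : _ ∧ _ => h1 h.1).trans ?_
      simp only [a, if_neg h1, zero_mul]
  have : Fintype {E : Fin N → Fin N // Function.Involutive E} := Fintype.ofFinite _
  have : Fintype (Setoid (Fin N)) := Fintype.ofFinite _
  -- Involution and partition are chosen independently, so sums of products factor. The instance on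
  -- `Str` is not the product instance, hence the comparison of the two index sets.
  have hs : ∀ {R : Type} [CommRing R]
      (f : {E : Fin N → Fin N // Function.Involutive E} → R) (g : Setoid (Fin N) → R),
      ∑ p : Str (Fin N), f p.1 * g p.2 = (∑ E, f E) * ∑ V, g V := by
    intro R _ f g
    rw [Finset.sum_mul_sum, ← Finset.sum_product']
    exact Finset.sum_congr (by ext; simp) fun _ _ => rfl
  have ha' : ∑ E, a' E = 1 := by
    rw [Finset.sum_eq_single ⟨id, fun _ => rfl⟩]
    · simp [a']
    · intro E _ hE
      refine if_neg fun h => hE (Subtype.ext (funext h))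
    · simp
  have hb' : ∑ V, b' V = 1 := by
    rw [Finset.sum_eq_single ⊥]
    · exact if_pos fun h k hk => hk
    · intro V _ hV
      exact if_neg fun h => hV (Setoid.ext fun h' k => ⟨h h' k, fun e => e ▸ V.refl' _⟩)
    · simp
  rw [h1, h2, h3, hs a b', hs a' b, hs (fun E => PowerSeries.C ((-1) ^ (N / 2) * a E)) b, ha', hb',
    ← map_sum, ← Finset.mul_sum, one_mul, mul_one]

theorem total_fin_zero {R : Type*} [CommRing R] {w : HGraph → R}
    (h : ∀ S : Str (Fin 0), w S.graph = 1) : total w (Fin 0) = 1 := by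
  have : Subsingleton (Str (Fin 0)) :=
    ⟨fun S T => Prod.ext (Subtype.ext (funext fun x => x.elim0)) (Setoid.ext fun x => x.elim0)⟩
  have : Unique (Str (Fin 0)) := uniqueOfSubsingleton ⟨⟨id, fun _ => rfl⟩, ⊥⟩
  rw [total, Fintype.sum_unique, h]

theorem totalConn_fin_zero {R : Type*} [CommRing R] (w : HGraph → R) :
    totalConn w (Fin 0) = 0 := by
  classical
  rw [totalConn, Finset.filter_false_of_mem, Finset.sum_empty]
  rintro S _ ⟨⟨x⟩, _⟩
  exact Fin.elim0 x

theorem connected_onlyLeaves_iff {G : HGraph} (h : ∀ h : G.H, G.E h = h) (a : G.H) :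
    G.Connected ↔ G.V = ⊤ := by
  constructor
  · intro hc
    refine Setoid.ext fun x z => iff_of_true ?_ trivial
    have := hc.2 x z
    induction this with
    | refl => exact G.V.refl' _
    | tail _ hbc ih =>
      rcases hbc with hbc | hbc
      · exact G.V.trans' ih hbc
      · rw [hbc, h]
        exact ih
  · intro hV
    refine ⟨⟨a⟩, fun x z => Relation.ReflTransGen.single (Or.inl ?_)⟩
    rw [hV]
    trivial

/-- Without edges, connectedness forces a single block; its excess is N - 2. -/
theorem totalConn_vertexWeight (N : ℕ) :
    totalConn vertexWeight (Fin N) = if 3 ≤ N then PowerSeries.X ^ (N - 2) else 0 := by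
  classical
  rcases N with _ | N
  · exact totalConn_fin_zero _
  let S₀ : Str (Fin (N + 1)) := ⟨⟨id, fun _ => rfl⟩, ⊤⟩
  have hex : S₀.graph.excess = N + 1 - 2 := by
    have h1 : Nat.card (Quotient (⊤ : Setoid (Fin (N + 1)))) = 1 := by
      have : Subsingleton (Quotient (⊤ : Setoid (Fin (N + 1)))) :=
        ⟨fun x z => by
          induction x using Quotient.inductionOn
          induction z using Quotient.inductionOn
          exact Quotient.sound trivial⟩
      have : Nonempty (Quotient (⊤ : Setoid (Fin (N + 1)))) := ⟨Quotient.mk _ 0⟩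
      exact Nat.card_unique
    have h2 : Nat.card (Fin (N + 1)) = N + 1 := by simp
    change Nat.card (Fin (N + 1)) - 2 * Nat.card (Quotient (⊤ : Setoid (Fin (N + 1)))) = _
    rw [h1, h2]
  rw [totalConn, Finset.sum_eq_single S₀]
  · have : ((∀ h, S₀.graph.E h = h) ∧ ∀ h, 3 ≤ {k | S₀.graph.V h k}.ncard) ↔ 3 ≤ N + 1 := by
      have : ∀ h : Fin (N + 1), {k | S₀.graph.V h k} = (Set.univ : Set (Fin (N + 1))) :=
        fun h => Set.eq_univ_of_forall fun _ => trivial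
      constructor
      · rintro ⟨_, h⟩
        have h' := h 0
        rw [this, Set.ncard_univ] at h'
        simpa using h'
      · intro h
        refine ⟨fun _ => rfl, fun x => ?_⟩
        rw [this, Set.ncard_univ]
        simpa using h
    rw [vertexWeight, hex]
    simp only [this]
  · intro S hS hne
    simp only [Finset.mem_filter, Finset.mem_univ, true_and] at hS
    refine if_neg fun h => hne ?_
    exact Prod.ext (Subtype.ext (funext h.1))
      ((connected_onlyLeaves_iff (G := S.graph) h.1 (0 : Fin (N + 1))).mp hS)
  · intro h
    exfalso
    apply h
    simp only [Finset.mem_filter, Finset.mem_univ, true_and]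
    exact (connected_onlyLeaves_iff (G := S₀.graph) (fun _ => rfl) (0 : Fin (N + 1))).mpr rfl

theorem connected_discrete {G : HGraph} (h : ∀ h k : G.H, G.V h k → h = k) (hc : G.Connected)
    (a b : G.H) : b = a ∨ b = G.E a := by
  have := hc.2 a b
  induction this with
  | refl => exact Or.inl rfl
  | tail _ hbc ih =>
    rcases hbc with hbc | rfl
    · exact h _ _ hbc ▸ ih
    · rcases ih with rfl | rfl
      · exact Or.inr rfl
      · exact Or.inl (G.E_involutive a)

theorem totalConn_matchingWeight (N : ℕ) :
    totalConn matchingWeight (Fin N) = if N = 2 then 1 else 0 := by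
  classical
  split_ifs with hN
  · subst hN
    let S₀ : Str (Fin 2) := ⟨⟨Equiv.swap 0 1, fun x => Equiv.swap_apply_self _ _ _⟩, ⊥⟩
    rw [totalConn, Finset.sum_eq_single S₀]
    · refine if_pos ⟨?_, fun h k hk => hk⟩
      change ∀ h : Fin 2, Equiv.swap 0 1 h ≠ h
      decide
    · intro S hS hne
      refine if_neg fun h => hne ?_
      refine Prod.ext (Subtype.ext (funext fun x => ?_)) (Setoid.ext fun x z => ?_)
      · have h1 : S.1.1 x ≠ x := h.1 x
        have h2 : ∀ x z : Fin 2, z ≠ x → z = Equiv.swap 0 1 x := by decide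
        exact h2 _ _ h1
      · exact ⟨fun hh => h.2 _ _ hh, fun e => (show x = z from e) ▸ S.2.refl' _⟩
    · intro h
      exfalso
      apply h
      simp only [Finset.mem_filter, Finset.mem_univ, true_and]
      refine (connected_iff_reach (G := S₀.graph) (0 : Fin 2)).mpr fun b => ?_
      have h2 : ∀ z : Fin 2, z = 0 ∨ z = Equiv.swap 0 1 0 := by decide
      rcases h2 b with h | h
      · rw [h]
        exact Relation.ReflTransGen.refl
      · exact Relation.ReflTransGen.single (Or.inr h)
  · refine Finset.sum_eq_zero fun S hS => ?_
    simp only [Finset.mem_filter, Finset.mem_univ, true_and] at hS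
    refine if_neg fun h => hN ?_
    obtain ⟨a⟩ := hS.1
    have hu : ({a, S.1.1 a} : Finset (Fin N)) = Finset.univ := by
      ext b
      have := connected_discrete (G := S.graph) h.2 hS a b
      simpa using this
    have := congrArg Finset.card hu
    have hne : a ≠ S.1.1 a := fun e => h.1 a e.symm
    rw [Finset.card_pair hne, Finset.card_univ, Fintype.card_fin] at this
    exact this.symm

theorem total_matchingWeight_zero : total matchingWeight (Fin 0) = 1 :=
  total_fin_zero fun _ => if_pos ⟨fun x => Fin.elim0 x, fun x => Fin.elim0 x⟩

theorem total_matchingWeight_one : total matchingWeight (Fin 1) = 0 := by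
  rw [total_fin_succ isMultiplicative_matchingWeight]
  simp [totalConn_matchingWeight]

/-- The component of a marked point consists of it and its partner, for which there are N + 1
choices. -/
theorem total_matchingWeight_succ_succ (N : ℕ) :
    total matchingWeight (Fin (N + 2)) = (N + 1) * total matchingWeight (Fin N) := by
  rw [total_fin_succ isMultiplicative_matchingWeight, Finset.sum_eq_single 1]
  · simp [totalConn_matchingWeight]
  · intro j _ hj
    rw [totalConn_matchingWeight, if_neg (by omega), zero_mul, mul_zero]
  · intro h
    exact absurd (Finset.mem_range.mpr (by omega)) h

theorem total_graphWeight_zero : total graphWeight (Fin 0) = 1 :=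
  total_fin_zero fun S => by
    have h0 : Nat.card S.graph.H = 0 := Nat.card_eq_fintype_card (α := Fin 0)
    rw [graphWeight, if_pos ⟨fun x => Fin.elim0 x, fun x => Fin.elim0 x⟩, excess, h0]
    simp

theorem total_vertexWeight_zero : total vertexWeight (Fin 0) = 1 :=
  total_fin_zero fun S => by
    have h0 : Nat.card S.graph.H = 0 := Nat.card_eq_fintype_card (α := Fin 0)
    rw [vertexWeight, if_pos ⟨fun x => Fin.elim0 x, fun x => Fin.elim0 x⟩, excess, h0]
    simp

end HGraph

/-! ### Exponential generating functions -/

namespace PolySeries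

open PowerSeries

/-- The exponential generating function of a sequence of power series `a N` of order at least
`N / 3`. -/
def egf (a : ℕ → PowerSeries ℚ) : PowerSeries (Polynomial ℚ) :=
  PowerSeries.mk fun r => ∑ N ∈ Finset.range (3 * r + 1),
    Polynomial.monomial N (coeff r (a N) / N.factorial)

theorem coeff_coeff_egf {a : ℕ → PowerSeries ℚ} (ha : ∀ N r, 3 * r < N → coeff r (a N) = 0)
    (r N : ℕ) : (coeff r (egf a)).coeff N = coeff r (a N) / N.factorial := by
  rw [egf, coeff_mk, Polynomial.finsetSum_coeff]
  simp only [Polynomial.coeff_monomial]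
  rw [Finset.sum_ite_eq']
  split_ifs with h
  · rfl
  · rw [Finset.mem_range] at h
    rw [ha N r (by omega), zero_div]

/-- The binomial convolution of the recursion becomes a product of exponential generating functions;
the shift N + 1 is differentiation in y. -/
theorem dy_egf {a c : ℕ → PowerSeries ℚ} (ha : ∀ N r, 3 * r < N → coeff r (a N) = 0)
    (hc : ∀ N r, 3 * r < N → coeff r (c N) = 0)
    (h : ∀ N, a (N + 1) = ∑ j ∈ Finset.range (N + 1),
      (N.choose j : PowerSeries ℚ) * (c (j + 1) * a (N - j))) :
    dy (egf a) = dy (egf c) * egf a := by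
  have hcast : ∀ (n : ℕ) (f : PowerSeries ℚ) (r : ℕ),
      coeff r ((n : PowerSeries ℚ) * f) = (n : ℚ) * coeff r f := by
    intro n f r
    rw [← nsmul_eq_mul, map_nsmul, nsmul_eq_mul]
  have hd : ∀ {b : ℕ → PowerSeries ℚ} (_ : ∀ N r, 3 * r < N → coeff r (b N) = 0) (r N : ℕ),
      (Polynomial.derivative (coeff r (egf b))).coeff N = coeff r (b (N + 1)) / N.factorial := by
    intro b hb r N
    rw [Polynomial.coeff_derivative, coeff_coeff_egf hb, Nat.factorial_succ]
    have h1 : ((N.factorial : ℕ) : ℚ) ≠ 0 := by positivity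
    have h2 : (N : ℚ) + 1 ≠ 0 := by positivity
    push_cast
    field_simp
  ext r N
  rw [coeff_dy, hd ha, coeff_mul, Polynomial.finsetSum_coeff, h, map_sum, Finset.sum_div]
  simp only [Polynomial.coeff_mul, coeff_dy, hd hc, coeff_coeff_egf ha]
  rw [Finset.sum_comm, Finset.Nat.sum_antidiagonal_eq_sum_range_succ (fun i j =>
    ∑ p ∈ Finset.HasAntidiagonal.antidiagonal r,
      coeff p.1 (c (i + 1)) / (i.factorial : ℚ) * (coeff p.2 (a j) / (j.factorial : ℚ)))]
  refine Finset.sum_congr rfl fun j hj => ?_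
  rw [Finset.mem_range] at hj
  rw [hcast, coeff_mul, Finset.mul_sum, Finset.sum_div]
  refine Finset.sum_congr rfl fun p _ => ?_
  rw [Nat.cast_choose ℚ (show j ≤ N by omega)]
  have h1 : ((N.factorial : ℕ) : ℚ) ≠ 0 := by positivity
  have h2 : ((j.factorial : ℕ) : ℚ) ≠ 0 := by positivity
  have h3 : (((N - j).factorial : ℕ) : ℚ) ≠ 0 := by positivity
  field_simp

theorem ev_zero_egf {a : ℕ → PowerSeries ℚ} (ha : ∀ N r, 3 * r < N → coeff r (a N) = 0) :
    ev 0 (egf a) = a 0 := by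
  ext1 r
  rw [coeff_ev, ← Polynomial.coeff_zero_eq_eval_zero, coeff_coeff_egf ha]
  simp

theorem coeff_ev_one_egf (a : ℕ → PowerSeries ℚ) (r : ℕ) : coeff r (ev 1 (egf a)) =
    ∑ N ∈ Finset.range (3 * r + 1), coeff r (a N) / N.factorial := by
  rw [coeff_ev, egf, coeff_mk, Polynomial.eval_finsetSum]
  simp

theorem coeff_zero_dy_egf (a : ℕ → PowerSeries ℚ) : coeff 0 (dy (egf a)) = 0 := by
  rw [coeff_dy, egf, coeff_mk]
  simp

end PolySeries

/-! ### The graph series as a formal Gaussian integral -/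

namespace HGraph

open PowerSeries PolySeries

theorem card_le_three_mul_excess {G : HGraph} (h : ∀ h : G.H, 3 ≤ {k : G.H | G.V h k}.ncard) :
    Nat.card G.H ≤ 3 * G.excess := by
  have := three_mul_v_le h
  rw [excess]
  omega

theorem coeff_graphWeight_eq_zero {G : HGraph} {r : ℕ} (h : 3 * r < Nat.card G.H) :
    coeff r (graphWeight G) = 0 := by
  rw [graphWeight]
  split_ifs with hG
  · have := card_le_three_mul_excess hG.2
    have hc : ((-1 : PowerSeries ℚ) ^ (Nat.card G.H / 2)) =
        PowerSeries.C ((-1) ^ (Nat.card G.H / 2)) := by simp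
    rw [hc, coeff_C_mul, coeff_X_pow, if_neg (by omega), mul_zero]
  · exact map_zero _

theorem coeff_vertexWeight_eq_zero {G : HGraph} {r : ℕ} (h : 3 * r < Nat.card G.H) :
    coeff r (vertexWeight G) = 0 := by
  rw [vertexWeight]
  split_ifs with hG
  · have := card_le_three_mul_excess hG.2
    rw [coeff_X_pow, if_neg (by omega)]
  · exact map_zero _

theorem card_graph_fin {N : ℕ} (S : Str (Fin N)) : Nat.card S.graph.H = N :=
  Nat.card_fin N

theorem coeff_total_eq_zero {w : HGraph → PowerSeries ℚ}
    (hw : ∀ G r, 3 * r < Nat.card G.H → coeff r (w G) = 0) (N r : ℕ) (h : 3 * r < N) :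
    coeff r (total w (Fin N)) = 0 := by
  rw [total, map_sum]
  refine Finset.sum_eq_zero fun S _ => hw _ _ ?_
  rwa [card_graph_fin]

theorem coeff_totalConn_eq_zero {w : HGraph → PowerSeries ℚ}
    (hw : ∀ G r, 3 * r < Nat.card G.H → coeff r (w G) = 0) (N r : ℕ) (h : 3 * r < N) :
    coeff r (totalConn w (Fin N)) = 0 := by
  rw [totalConn, map_sum]
  refine Finset.sum_eq_zero fun S _ => hw _ _ ?_
  rwa [card_graph_fin]

theorem egf_totalConn_vertexWeight :
    egf (fun N => totalConn vertexWeight (Fin N)) = potential := by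
  ext r N
  rw [coeff_coeff_egf (coeff_totalConn_eq_zero fun _ _ => coeff_vertexWeight_eq_zero), potential,
    coeff_mk, totalConn_vertexWeight]
  by_cases hr : r = 0
  · subst hr
    rw [if_pos rfl, Polynomial.coeff_zero]
    split_ifs with h1
    · rw [coeff_X_pow, if_neg (by omega), zero_div]
    · rw [map_zero, zero_div]
  · rw [if_neg hr, Polynomial.coeff_C_mul, Polynomial.coeff_X_pow]
    by_cases hN : N = r + 2
    · subst hN
      rw [if_pos (by omega), coeff_X_pow, if_pos (by omega), if_pos rfl, mul_one]
    · rw [if_neg hN, mul_zero]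
      split_ifs with h
      · rw [coeff_X_pow, if_neg (by omega), zero_div]
      · rw [map_zero, zero_div]

/-- The moments of the Gaussian functional, a signed count of perfect matchings. -/
def gaussianMoment (N : ℕ) : ℚ := (-1) ^ (N / 2) * total matchingWeight (Fin N)

theorem gaussianMoment_succ_succ (N : ℕ) :
    gaussianMoment (N + 2) = -(N + 1) * gaussianMoment N := by
  rw [gaussianMoment, gaussianMoment, total_matchingWeight_succ_succ,
    Nat.add_div_right N two_pos, pow_succ]
  ring

/-- The Gaussian functional on polynomials. -/
def gaussian : Polynomial ℚ →ₗ[ℚ] ℚ :=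
  Polynomial.lsum fun N => LinearMap.lsmul ℚ ℚ (gaussianMoment N)

theorem gaussian_monomial (N : ℕ) (a : ℚ) :
    gaussian (Polynomial.monomial N a) = gaussianMoment N * a := by
  rw [gaussian, Polynomial.lsum_apply, Polynomial.sum_monomial_index _ _ (by simp)]
  rfl

theorem gaussian_X_mul (p : Polynomial ℚ) :
    gaussian (Polynomial.X * p) = -gaussian (Polynomial.derivative p) := by
  induction p using Polynomial.induction_on' with
  | add p q hp hq => rw [mul_add, map_add, hp, hq, Polynomial.derivative_add, map_add, neg_add]
  | monomial N a =>
    rw [Polynomial.X_mul_monomial, Polynomial.derivative_monomial, gaussian_monomial,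
      gaussian_monomial]
    rcases N with _ | N
    · simp [gaussianMoment, total_matchingWeight_one]
    · rw [gaussianMoment_succ_succ, Nat.add_sub_cancel]
      push_cast
      ring

theorem gaussian_one : gaussian 1 = 1 := by
  rw [← Polynomial.monomial_zero_one, gaussian_monomial, gaussianMoment, total_matchingWeight_zero]
  simp

/-- The generating function of all graphs is a formal Gaussian integral. -/
theorem ev_one_egf_total_graphWeight : ev 1 (egf fun N => total graphWeight (Fin N)) =
    mapCoeff gaussian (egf fun N => total vertexWeight (Fin N)) := by
  ext1 r
  rw [coeff_ev_one_egf, coeff_mapCoeff, egf, coeff_mk, map_sum]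
  refine Finset.sum_congr rfl fun N _ => ?_
  rw [gaussian_monomial, total_graphWeight, coeff_C_mul, gaussianMoment, mul_div_assoc]

/-- The value of the weighted sum of all connected graphs with Euler characteristic `-n`. -/
theorem coeff_ev_one_egf_totalConn_graphWeight {n : ℕ} (hn : n ≠ 0) :
    coeff (2 * n) (ev 1 (egf fun N => totalConn graphWeight (Fin N))) =
      -(bernoulli (n + 1) / ((n : ℚ) * ((n : ℚ) + 1))) := by
  have bg := coeff_total_eq_zero (w := graphWeight) fun _ _ => coeff_graphWeight_eq_zero
  have bgc := coeff_totalConn_eq_zero (w := graphWeight) fun _ _ => coeff_graphWeight_eq_zero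
  have bv := coeff_total_eq_zero (w := vertexWeight) fun _ _ => coeff_vertexWeight_eq_zero
  have bvc := coeff_totalConn_eq_zero (w := vertexWeight) fun _ _ => coeff_vertexWeight_eq_zero
  refine coeff_log_formal_integral (L := gaussian)
    (P := egf fun N => total vertexWeight (Fin N)) gaussian_X_mul gaussian_one ?_ ?_ ?_ hn
  · rw [← egf_totalConn_vertexWeight]
    exact dy_egf bv bvc (total_fin_succ isMultiplicative_vertexWeight)
  · rw [ev_zero_egf bv, total_vertexWeight_zero]
  · rw [← ev_one_egf_total_graphWeight, ← ev_derivative, ← ev_derivative, ← map_mul]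
    congr 1
    refine derivative_eq_mul_of_dy_eq_mul (coeff_zero_dy_egf _)
      (dy_egf bg bgc (total_fin_succ isMultiplicative_graphWeight)) ?_ ?_
    · rw [ev_zero_egf bg, total_graphWeight_zero]
    · rw [ev_zero_egf bgc, totalConn_fin_zero]

end HGraph

/-! ### Isomorphism classes -/

namespace HGraph

theorem Iso.toEquiv_injective {G G' : HGraph} :
    Function.Injective (Iso.toEquiv : Iso G G' → (G.H ≃ G'.H)) := by
  rintro ⟨f, _, _⟩ ⟨g, _, _⟩ h
  cases h
  rfl

instance finite_iso (G G' : HGraph) : Finite (Iso G G') :=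
  Finite.of_injective _ Iso.toEquiv_injective

theorem card_iso_eq_card_aut {G G' : HGraph} (f : Iso G G') :
    Nat.card (Iso G G') = Nat.card G'.Aut :=
  Nat.card_congr
    { toFun := fun g => f.symm.trans g
      invFun := fun g => f.trans g
      left_inv := fun g => Iso.toEquiv_injective (Equiv.ext fun x => by simp [Iso.trans, Iso.symm])
      right_inv := fun g =>
        Iso.toEquiv_injective (Equiv.ext fun x => by simp [Iso.trans, Iso.symm]) }

/-- The structure on the half-edges of a graph. -/
def str (G : HGraph) : Str G.H := ⟨⟨G.E, G.E_involutive⟩, G.V⟩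

/-- Labellings of the half-edges of `G` correspond to structures isomorphic to `G`. -/
theorem iso_toEquiv_bijective (G : HGraph) (N : ℕ) : 
    Function.Bijective (α := Σ S : Str (Fin N), Iso S.graph G) (β := Fin N ≃ G.H)
      fun p => p.2.toEquiv := by
  constructor
  · rintro ⟨S, f⟩ ⟨S', f'⟩ h
    have h : f.toEquiv = f'.toEquiv := h
    have hS : S = S' := by
      refine Prod.ext (Subtype.ext (funext fun x => ?_)) (Setoid.ext fun x z => ?_)
      · apply f.toEquiv.injective
        have h1 := f.map_E x
        have h2 := f'.map_E x
        rw [← h] at h2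
        exact h1.trans h2.symm
      · have h1 := f.map_V x z
        have h2 := f'.map_V x z
        rw [← h] at h2
        exact h1.trans h2.symm
    subst hS
    rw [Iso.toEquiv_injective h]
  · intro e
    exact ⟨⟨G.str.map e.symm, (G.str.mapIso e.symm).symm⟩, Equiv.ext fun x => rfl⟩

-- Count bijections from `Fin N` to the half-edges: each one determines the structure it pulls back,
-- and a structure isomorphic to G arises from |Aut G| of them.
open Classical in
theorem factorial_card_eq (G : HGraph) (N : ℕ) :
    ∑ S : Str (Fin N), (if Nonempty (Iso S.graph G) then Nat.card G.Aut else 0) =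
      if N = Nat.card G.H then N.factorial else 0 := by
  have h1 : ∀ S : Str (Fin N), (if Nonempty (Iso S.graph G) then Nat.card G.Aut else 0) =
      Nat.card (Iso S.graph G) := by
    intro S
    split_ifs with h
    · exact (card_iso_eq_card_aut h.some).symm
    · have := not_nonempty_iff.mp h
      exact Nat.card_of_isEmpty.symm
  rw [Finset.sum_congr rfl fun S _ => h1 S, ← Nat.card_sigma,
    Nat.card_congr (Equiv.ofBijective _ (iso_toEquiv_bijective G N))]
  have := Fintype.ofFinite G.H
  split_ifs with h
  · have e : Fin N ≃ G.H := (finCongr h).trans (Finite.equivFin G.H).symm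
    rw [Nat.card_eq_fintype_card, Fintype.card_equiv e, Fintype.card_fin]
  · have : IsEmpty (Fin N ≃ G.H) := ⟨fun e => h (by rw [← Nat.card_congr e, Nat.card_fin])⟩
    exact Nat.card_of_isEmpty

open Classical in
theorem one_div_card_aut (G : HGraph) {M : ℕ} (hM : Nat.card G.H < M) :
    1 / (Nat.card G.Aut : ℚ) = ∑ N ∈ Finset.range M, ∑ S : Str (Fin N),
      (if Nonempty (Iso S.graph G) then 1 else 0) / (N.factorial : ℚ) := by
  have hne : (Nat.card G.Aut : ℚ) ≠ 0 := by
    have : Nonempty G.Aut := ⟨Iso.refl G⟩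
    exact_mod_cast Nat.card_pos.ne'
  have h : ∀ N : ℕ, (∑ S : Str (Fin N),
      (if Nonempty (Iso S.graph G) then 1 else 0) / (N.factorial : ℚ)) * Nat.card G.Aut =
      if N = Nat.card G.H then 1 else 0 := by
    intro N
    have hN : (N.factorial : ℚ) ≠ 0 := by positivity
    rw [← Finset.sum_div, div_mul_eq_mul_div, div_eq_iff hN, Finset.sum_mul]
    have := congrArg (Nat.cast : ℕ → ℚ) (factorial_card_eq G N)
    push_cast at this
    rw [ite_mul, one_mul, zero_mul, ← this]
    refine Finset.sum_congr rfl fun S _ => ?_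
    rw [ite_mul, one_mul, zero_mul]
  rw [div_eq_iff hne, Finset.sum_mul, Finset.sum_congr rfl fun N _ => h N, Finset.sum_ite_eq',
    if_pos (Finset.mem_range.mpr hM)]

theorem e_eq_of_iso {G G' : HGraph} (f : Iso G G') (h : ∀ h : G.H, G.E h ≠ h) : G.e = G'.e := by
  have h1 := two_mul_e h
  have h2 := two_mul_e (noLeaf_of_iso f h)
  rw [card_eq_of_iso f] at h1
  omega

theorem admissible_of_iso {G G' : HGraph} (f : Iso G G') (h : G.Admissible) : G'.Admissible :=
  ⟨noLeaf_of_iso f h.1, thick_of_iso f h.2⟩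

theorem eulerChar_eq_iff {G : HGraph} (h : G.Admissible) (n : ℕ) :
    G.eulerChar = -(n : ℤ) ↔ G.excess = 2 * n := by
  have h1 := two_mul_e h.1
  have h2 := three_mul_v_le h.2
  rw [eulerChar, excess]
  omega

theorem coeff_graphWeight (n : ℕ) (G : HGraph) [Decidable (G.Admissible ∧ G.eulerChar = -(n : ℤ))] :
    PowerSeries.coeff (2 * n) (graphWeight G) =
      if G.Admissible ∧ G.eulerChar = -(n : ℤ) then (-1) ^ G.e else 0 := by
  by_cases h : G.Admissible
  · have hc : ((-1 : PowerSeries ℚ) ^ (Nat.card G.H / 2)) = PowerSeries.C ((-1) ^ G.e) := by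
      rw [← two_mul_e h.1, Nat.mul_div_cancel_left _ two_pos]
      simp
    rw [graphWeight, if_pos (And.intro h.1 h.2), hc, PowerSeries.coeff_C_mul, PowerSeries.coeff_X_pow, mul_ite,
      mul_one, mul_zero]
    refine if_congr ?_ rfl rfl
    rw [eulerChar_eq_iff h]
    exact ⟨fun e => ⟨h, e.symm⟩, fun e => e.2.symm⟩
  · rw [graphWeight, if_neg fun h' : _ ∧ _ => h ⟨h'.1, h'.2⟩, map_zero, if_neg fun h' => h h'.1]

end HGraph

namespace ConnClass

open HGraph

theorem rep_admissible (c : ConnClass) : c.rep.Admissible := (Quotient.out c).2.1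

theorem rep_connected (c : ConnClass) : c.rep.Connected := (Quotient.out c).2.2

/-- The class of a connected admissible graph. -/
def mk (G : HGraph) (h : G.Admissible ∧ G.Connected) : ConnClass :=
  Quotient.mk ConnGraph.setoid ⟨G, h⟩

theorem rep_mk (G : HGraph) (h : G.Admissible ∧ G.Connected) : Nonempty (Iso (mk G h).rep G) :=
  Quotient.mk_out (s := ConnGraph.setoid) ⟨G, h⟩

theorem eq_mk_of_iso (c : ConnClass) {G : HGraph} (h : G.Admissible ∧ G.Connected)
    (f : Iso G c.rep) : c = mk G h := by
  rw [← Quotient.out_eq c]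
  exact Quotient.sound (s := ConnGraph.setoid) ⟨f.symm⟩

theorem card_le_of_mem {n : ℕ} {c : ConnClass} (hc : c ∈ classesOfEulerChar n) :
    Nat.card c.rep.H ≤ 3 * (2 * n) := by
  have h1 := (eulerChar_eq_iff c.rep_admissible n).mp hc
  rw [← h1]
  exact card_le_three_mul_excess c.rep_admissible.2

theorem finite_classesOfEulerChar (n : ℕ) : (classesOfEulerChar n).Finite := by
  let T := Σ N : Fin (3 * (2 * n) + 1),
    {S : Str (Fin N) // S.graph.Admissible ∧ S.graph.Connected}
  refine (Set.finite_range fun p : T => mk p.2.1.graph p.2.2).subset fun c hc => ?_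
  have hN := card_le_of_mem hc
  let e : c.rep.H ≃ Fin (Nat.card c.rep.H) := Finite.equivFin _
  let f := c.rep.str.mapIso e
  exact ⟨⟨⟨Nat.card c.rep.H, Nat.lt_succ_of_le hN⟩, c.rep.str.map e,
    admissible_of_iso f c.rep_admissible, (connected_iff_of_iso f).mp c.rep_connected⟩,
    (eq_mk_of_iso c _ f.symm).symm⟩

-- A graph is isomorphic to the representative of at most one class, so the sum has at most one
-- non-zero term.
open Classical in
theorem sum_iso_rep (n : ℕ) (G : HGraph) :
    ∑ c ∈ (finite_classesOfEulerChar n).toFinset,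
      (if Nonempty (Iso G c.rep) then (-1 : ℚ) ^ c.rep.e else 0) =
        if G.Connected then PowerSeries.coeff (2 * n) (graphWeight G) else 0 := by
  rw [coeff_graphWeight]
  by_cases h : G.Connected ∧ G.Admissible ∧ G.eulerChar = -(n : ℤ)
  · obtain ⟨f⟩ := rep_mk G ⟨h.2.1, h.1⟩
    rw [if_pos h.1, if_pos h.2, Finset.sum_eq_single (mk G ⟨h.2.1, h.1⟩)]
    · rw [if_pos ⟨f.symm⟩, e_eq_of_iso f (rep_admissible _).1]
    · intro c _ hc
      exact if_neg fun ⟨g⟩ => hc (eq_mk_of_iso c _ g)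
    · intro hc
      exfalso
      apply hc
      rw [Set.Finite.mem_toFinset]
      change HGraph.eulerChar _ = _
      rw [eulerChar, v_eq_of_iso f, e_eq_of_iso f (rep_admissible _).1]
      exact h.2.2
  · have hr : (if G.Connected then
        if G.Admissible ∧ G.eulerChar = -(n : ℤ) then (-1 : ℚ) ^ G.e else 0 else 0) = 0 := by
      by_cases h1 : G.Connected
      · rw [if_pos h1, if_neg fun h2 => h ⟨h1, h2⟩]
      · rw [if_neg h1]
    rw [hr]
    refine Finset.sum_eq_zero fun c hc => if_neg fun ⟨f⟩ => h ?_
    rw [Set.Finite.mem_toFinset] at hc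
    have ha := admissible_of_iso f.symm c.rep_admissible
    refine ⟨(connected_iff_of_iso f).mpr c.rep_connected, ha, ?_⟩
    rw [eulerChar, v_eq_of_iso f, e_eq_of_iso f ha.1]
    exact hc

/-- The sum over isomorphism classes as a sum over labelled structures. -/
theorem finsum_classesOfEulerChar (n : ℕ) :
    ∑ᶠ c ∈ classesOfEulerChar n, (-1 : ℚ) ^ c.rep.e / (Nat.card c.rep.Aut : ℚ) =
      PowerSeries.coeff (2 * n)
        (PolySeries.ev 1 (PolySeries.egf fun N => totalConn graphWeight (Fin N))) := by
  classical
  rw [finsum_mem_eq_finite_toFinset_sum _ (finite_classesOfEulerChar n),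
    PolySeries.coeff_ev_one_egf]
  have h : ∀ c ∈ (finite_classesOfEulerChar n).toFinset,
      (-1 : ℚ) ^ c.rep.e / (Nat.card c.rep.Aut : ℚ) =
        ∑ N ∈ Finset.range (3 * (2 * n) + 1), ∑ S : Str (Fin N),
          (if Nonempty (Iso S.graph c.rep) then (-1 : ℚ) ^ c.rep.e else 0) /
            (N.factorial : ℚ) := by
    intro c hc
    rw [Set.Finite.mem_toFinset] at hc
    rw [div_eq_mul_one_div, one_div_card_aut c.rep (Nat.lt_succ_of_le (card_le_of_mem hc)),
      Finset.mul_sum]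
    refine Finset.sum_congr rfl fun N _ => ?_
    rw [Finset.mul_sum]
    refine Finset.sum_congr rfl fun S _ => ?_
    rw [← mul_div_assoc, mul_ite, mul_one, mul_zero]
  rw [Finset.sum_congr rfl h, Finset.sum_comm]
  refine Finset.sum_congr rfl fun N _ => ?_
  rw [Finset.sum_comm, totalConn, map_sum, Finset.sum_div, Finset.sum_filter]
  refine Finset.sum_congr rfl fun S _ => ?_
  rw [← Finset.sum_div, sum_iso_rep, ite_div, zero_div]

end ConnClass

/-! ### The fundamental group -/

namespace HGraph

variable (G : HGraph)

/-- A vertex as an object of the fundamental groupoid. -/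
abbrev obj (a : G.Vertex) : G.FundGroupoid :=
  (CategoryTheory.Quotient.functor G.Backtrack).obj ((Paths.of G.Vertex).obj a)

/-- An oriented edge as a morphism of the fundamental groupoid. -/
def arrow {a b : G.Vertex} (h : a ⟶ b) : G.obj a ⟶ G.obj b :=
  (CategoryTheory.Quotient.functor G.Backtrack).map ((Paths.of G.Vertex).map h)

variable {G}

theorem arrow_comp_reverse {a b : G.Vertex} (h : a ⟶ b) :
    G.arrow h ≫ G.arrow (G.reverse h) = 𝟙 _ := by
  have := CategoryTheory.Quotient.sound G.Backtrack (Backtrack.cancel h)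
  rw [CategoryTheory.Functor.map_comp, CategoryTheory.Functor.map_id] at this
  exact this

theorem reverse_reverse {a b : G.Vertex} (h : a ⟶ b) : G.reverse (G.reverse h) = h :=
  Subtype.ext (G.E_involutive h.1)

theorem reverse_comp_arrow {a b : G.Vertex} (h : a ⟶ b) :
    G.arrow (G.reverse h) ≫ G.arrow h = 𝟙 _ := by
  have := arrow_comp_reverse (G.reverse h)
  rwa [reverse_reverse] at this

/-- Every morphism of the fundamental groupoid is a composition of oriented edges. -/
theorem fundGroupoid_induction {P : ∀ {x y : G.FundGroupoid}, (x ⟶ y) → Prop}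
    (hid : ∀ a, P (𝟙 (G.obj a)))
    (hcomp : ∀ {a b c : G.Vertex} (f : G.obj a ⟶ G.obj b) (h : b ⟶ c), P f → P (f ≫ G.arrow h)) :
    ∀ {x y : G.FundGroupoid} (f : x ⟶ y), P f := by
  have key : ∀ {a b : G.Vertex} (p : Quiver.Path a b),
      P (x := G.obj a) (y := G.obj b) ((CategoryTheory.Quotient.functor G.Backtrack).map p) := by
    intro a b p
    induction p with
    | nil => exact hid a
    | cons p e ih => exact hcomp _ e ih
  rintro ⟨a⟩ ⟨b⟩ ⟨p⟩
  exact key p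

theorem isIso_fundGroupoid {x y : G.FundGroupoid} (f : x ⟶ y) : IsIso f := by
  refine fundGroupoid_induction (P := fun f => IsIso f) (fun a => inferInstance)
    (fun f h _ => ?_) f
  have : IsIso (G.arrow h) := ⟨G.arrow (G.reverse h), arrow_comp_reverse h, reverse_comp_arrow h⟩
  infer_instance

instance groupoidFundGroupoid : Groupoid G.FundGroupoid :=
  Groupoid.ofIsIso fun f => isIso_fundGroupoid f

/-- The functor to a group that is given by labels of the half-edges. -/
def functorOfLabels {M : Type} [Group M] (x : G.H → M) (hx : ∀ h, x (G.E h) = (x h)⁻¹) :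
    G.FundGroupoid ⥤ SingleObj M :=
  CategoryTheory.Quotient.lift G.Backtrack
    (Paths.lift { obj := fun _ => SingleObj.star M, map := fun h => (x h.1 : M) })
    (by
      rintro _ _ _ _ ⟨h⟩
      rw [CategoryTheory.Functor.map_comp, CategoryTheory.Functor.map_id]
      -- Composition in `SingleObj M` multiplies in reverse order, so the backtrack gives x (E h) *
      -- x h.
      refine (congrArg₂ (fun a b : M => a * b) (Paths.lift_toPath _ (G.reverse h))
        (Paths.lift_toPath _ h)).trans ?_
      change x (G.E h.1) * x h.1 = 1
      rw [hx, inv_mul_cancel])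

theorem functorOfLabels_arrow {M : Type} [Group M] (x : G.H → M)
    (hx : ∀ h, x (G.E h) = (x h)⁻¹) {a b : G.Vertex} (h : a ⟶ b) :
    (functorOfLabels x hx).map (G.arrow h) = x h.1 :=
  Paths.lift_toPath _ h

theorem functor_ext {M : Type} [Group M] {F F' : G.FundGroupoid ⥤ SingleObj M}
    (hF : ∀ {a b : G.Vertex} (h : a ⟶ b), F.map (G.arrow h) = F'.map (G.arrow h)) : F = F' := by
  refine Functor.hext (fun _ => rfl) fun x y f => heq_of_eq ?_
  refine fundGroupoid_induction (P := fun f => F.map f = F'.map f) (fun a => ?_)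
    (fun f h ih => ?_) f
  · rw [F.map_id, F'.map_id]
    rfl
  · rw [F.map_comp, F'.map_comp, hF, ih]

theorem map_arrow_reverse {M : Type} [Group M] (F : G.FundGroupoid ⥤ SingleObj M)
    {a b : G.Vertex} (h : a ⟶ b) :
    (F.map (G.arrow (G.reverse h)) : M) = (F.map (G.arrow h) : M)⁻¹ := by
  have := congrArg F.map (arrow_comp_reverse h)
  rw [F.map_comp, F.map_id] at this
  exact eq_inv_of_mul_eq_one_left this

/-- The oriented edge given by a half-edge. -/
def edge (h : G.H) : G.vert h ⟶ G.vert (G.E h) := ⟨h, rfl, rfl⟩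

theorem map_edge_E {M : Type} [Group M] (F : G.FundGroupoid ⥤ SingleObj M) (h : G.H) :
    (F.map (G.arrow (edge (G.E h))) : M) = (F.map (G.arrow (edge h)) : M)⁻¹ := by
  rw [← map_arrow_reverse]
  -- The edge of E h ends at the vertex of E (E h), which equals that of h only propositionally;
  -- hence the free endpoint c.
  have key : ∀ {c : G.Vertex} (k : G.vert (G.E h) ⟶ c), k.1 = G.E h →
      (F.map (G.arrow k) : M) = F.map (G.arrow (G.reverse (edge h))) := by
    rintro c ⟨k, hk1, hk2⟩ e
    have e : k = G.E h := e
    subst e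
    have hc : c = G.vert h := by rw [← hk2, G.E_involutive h]
    subst hc
    rfl
  exact key (edge (G.E h)) rfl

/-- Functors to a group are labellings of the half-edges. -/
def functorEquivLabels (M : Type) [Group M] :
    (G.FundGroupoid ⥤ SingleObj M) ≃ {x : G.H → M // ∀ h, x (G.E h) = (x h)⁻¹} where
  toFun F := ⟨fun h => F.map (G.arrow (edge h)), map_edge_E F⟩
  invFun x := functorOfLabels x.1 x.2
  left_inv F := by
    refine functor_ext ?_
    rintro a b ⟨h, rfl, rfl⟩
    exact functorOfLabels_arrow _ _ _
  right_inv x := Subtype.ext (funext fun h => functorOfLabels_arrow x.1 x.2 (edge h))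

/-- With an orientation `O`, labellings of the half-edges are functions on `O`. -/
def labelsEquiv {O : Set G.H} (hO : ∀ h, G.E h ∈ O ↔ h ∉ O) (M : Type) [Group M] :
    {x : G.H → M // ∀ h, x (G.E h) = (x h)⁻¹} ≃ (O → M) := by
  classical
  exact
  { toFun := fun x h => x.1 h
    invFun := fun f => ⟨fun h => if hh : h ∈ O then f ⟨h, hh⟩ else (f ⟨G.E h, (hO h).mpr hh⟩)⁻¹,
      fun h => by
        dsimp only
        by_cases hh : h ∈ O
        · have h' : G.E h ∉ O := fun h' => (hO h).mp h' hh
          rw [dif_neg h', dif_pos hh]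
          simp only [G.E_involutive h]
        · rw [dif_pos ((hO h).mpr hh), dif_neg hh, inv_inv]⟩
    left_inv := fun x => Subtype.ext (funext fun h => by
      by_cases hh : h ∈ O
      · exact dif_pos hh
      · refine (dif_neg hh).trans ?_
        dsimp only
        rw [x.2, inv_inv])
    right_inv := fun f => funext fun h => dif_pos h.2 }

/-- The fundamental groupoid is free on the edges, oriented in an arbitrary way. -/
theorem nonempty_isFreeGroupoid {O : Set G.H} (hO : ∀ h, G.E h ∈ O ↔ h ∉ O) :
    Nonempty (IsFreeGroupoid G.FundGroupoid) := ⟨{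
  quiverGenerators :=
    ⟨fun a b => {h : G.H // h ∈ O ∧ G.obj (G.vert h) = a ∧ G.obj (G.vert (G.E h)) = b}⟩
  of {a b} h := eqToHom h.2.2.1.symm ≫ G.arrow (edge h.1) ≫ eqToHom h.2.2.2
  unique_lift {X} _ f := by
    let x := (labelsEquiv hO X).symm fun h => f ⟨h.1, h.2, rfl, rfl⟩
    have hx : ∀ h : O, x.1 h = f ⟨h.1, h.2, rfl, rfl⟩ := fun h =>
      congrFun ((labelsEquiv hO X).apply_symm_apply fun h => f ⟨h.1, h.2, rfl, rfl⟩) h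
    refine ⟨functorOfLabels x.1 x.2, ?_, ?_⟩
    · rintro _ _ ⟨h, hh, rfl, rfl⟩
      rw [eqToHom_refl, eqToHom_refl, Category.id_comp, Category.comp_id, functorOfLabels_arrow]
      exact hx ⟨h, hh⟩
    · intro F hF
      apply (functorEquivLabels X).injective
      apply (labelsEquiv hO X).injective
      funext h
      have h1 := hF _ _ ⟨h.1, h.2, rfl, rfl⟩
      rw [eqToHom_refl, eqToHom_refl, Category.id_comp, Category.comp_id] at h1
      exact h1.trans ((functorOfLabels_arrow x.1 x.2 (edge h.1)).trans (hx h)).symm }⟩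

theorem Connected.nonempty_hom (hG : G.Connected) (a b : G.Vertex) :
    Nonempty (G.obj a ⟶ G.obj b) := by
  obtain ⟨h, rfl⟩ := Quotient.exists_rep a
  obtain ⟨k, rfl⟩ := Quotient.exists_rep b
  have := hG.2 h k
  induction this with
  | refl => exact ⟨𝟙 _⟩
  | @tail b c _ hbc ih =>
    obtain ⟨f⟩ := ih
    rcases hbc with hbc | rfl
    · have : Quotient.mk G.V b = Quotient.mk G.V c := Quotient.sound hbc
      rw [← this]
      exact ⟨f⟩
    · exact ⟨f ≫ G.arrow (edge b)⟩

theorem Connected.isConnected (hG : G.Connected) : IsConnected G.FundGroupoid := by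
  have : Nonempty G.FundGroupoid := hG.1.map fun h => G.obj (G.vert h)
  refine zigzag_isConnected fun x y => ?_
  obtain ⟨f⟩ := hG.nonempty_hom x.as y.as
  exact Zigzag.of_hom f

theorem isFreeGroup_fundGroup (hE : ∀ h : G.H, G.E h ≠ h) (hG : G.Connected) (a : G.Vertex) :
    IsFreeGroup (G.FundGroup a) := by
  obtain ⟨O, hO⟩ := exists_orientation hE
  obtain ⟨_⟩ := nonempty_isFreeGroupoid hO
  have := hG.isConnected
  exact IsFreeGroupoid.endIsFreeOfConnectedFree (G.obj a)

/-- A functor to a commutative group is given by its values on loops at `a` and on a path from `a`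
to each of the other vertices. -/
theorem bijective_functor_restrict {M : Type} [CommGroup M] {a : G.Vertex}
    (p : ∀ b, G.obj a ⟶ G.obj b) (hp : p a = 𝟙 _) :
    Function.Bijective (α := G.FundGroupoid ⥤ SingleObj M)
      (β := (G.FundGroup a →* M) × ({b : G.Vertex // b ≠ a} → M))
      fun F => (F.mapEnd (G.obj a), fun b => F.map (p b.1)) := by
  classical
  constructor
  · intro F F' h
    have h1 : ∀ f : G.obj a ⟶ G.obj a, F.map f = F'.map f := fun f =>
      DFunLike.congr_fun (congrArg Prod.fst h) f
    have h2 : ∀ b, F.map (p b) = F'.map (p b) := by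
      intro b
      by_cases hb : b = a
      · subst hb
        exact h1 _
      · exact congrFun (congrArg Prod.snd h) ⟨b, hb⟩
    refine functor_ext fun {b c} f => ?_
    have h3 : p b ≫ G.arrow f = (p b ≫ G.arrow f ≫ inv (p c)) ≫ p c := by simp
    have h4 : F.map (p b ≫ G.arrow f) = F'.map (p b ≫ G.arrow f) := by
      rw [h3, F.map_comp, F'.map_comp, h1, h2]
    rw [F.map_comp, F'.map_comp, h2] at h4
    exact mul_right_cancel (G := M) h4
  · rintro ⟨φ, t⟩
    let t' : G.FundGroupoid → M := fun x => if hb : x.as = a then 1 else t ⟨x.as, hb⟩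
    have ht' : t' (G.obj a) = 1 := dif_pos rfl
    let q : ∀ x : G.FundGroupoid, G.obj a ⟶ x := fun x => p x.as
    -- A morphism is closed up to a loop at a along the chosen paths, and the value of the loop is
    -- corrected by the values prescribed on these paths.
    let val : ∀ {x z : G.FundGroupoid}, (x ⟶ z) → M :=
      fun {x z} f => φ (q x ≫ f ≫ inv (q z)) * t' z * (t' x)⁻¹
    have hid : ∀ x : G.FundGroupoid, val (𝟙 x) = 1 := fun x => by
      change φ (q x ≫ 𝟙 x ≫ inv (q x)) * t' x * (t' x)⁻¹ = 1
      rw [Category.id_comp, IsIso.hom_inv_id, ← End.one_def, map_one, one_mul, mul_inv_cancel]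
    have hcomm : ∀ A B u v w : M, A * B * w * u⁻¹ = (A * w * v⁻¹) * (B * v * u⁻¹) := by
      intro A B u v w
      calc A * B * w * u⁻¹ = A * B * w * u⁻¹ * (v⁻¹ * v) := by rw [inv_mul_cancel, mul_one]
        _ = _ := by ac_rfl
    have hcomp : ∀ {x z w : G.FundGroupoid} (f : x ⟶ z) (g : z ⟶ w),
        val (f ≫ g) = val g * val f := fun {x z w} f g => by
      have h : q x ≫ (f ≫ g) ≫ inv (q w) =
          (q x ≫ f ≫ inv (q z)) ≫ (q z ≫ g ≫ inv (q w)) := by simp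
      have h' : φ (q x ≫ (f ≫ g) ≫ inv (q w)) =
          φ (q z ≫ g ≫ inv (q w)) * φ (q x ≫ f ≫ inv (q z)) := by
        rw [h, ← map_mul]
        rfl
      change φ (q x ≫ (f ≫ g) ≫ inv (q w)) * t' w * (t' x)⁻¹ = _
      rw [h']
      exact hcomm _ _ _ _ _
    let F : G.FundGroupoid ⥤ SingleObj M :=
      { obj := fun _ => SingleObj.star M
        map := fun f => val f
        map_id := hid
        map_comp := hcomp }
    refine ⟨F, Prod.ext (MonoidHom.ext fun f => ?_) (funext fun b => ?_)⟩
    · change φ (p a ≫ f ≫ inv (p a)) * t' (G.obj a) * (t' (G.obj a))⁻¹ = φ f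
      rw [ht', mul_one, inv_one, mul_one]
      congr 1
      rw [hp]
      simp
    · change φ (p a ≫ p b.1 ≫ inv (p b.1)) * t' (G.obj b.1) * (t' (G.obj a))⁻¹ = t b
      rw [ht', inv_one, mul_one, IsIso.hom_inv_id, Category.comp_id, hp, ← End.one_def, map_one,
        one_mul]
      exact dif_neg b.2

/-! ### The rank of the fundamental group -/

/-- The number of homomorphisms from the fundamental group to a group of order two. -/
theorem card_fundGroup_hom (hE : ∀ h : G.H, G.E h ≠ h) (hG : G.Connected) (a : G.Vertex) :
    2 ^ G.e = Nat.card (G.FundGroup a →* Multiplicative (ZMod 2)) * 2 ^ (G.v - 1) := by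
  classical
  obtain ⟨O, hO⟩ := exists_orientation hE
  have hfin : Finite G.Vertex := inferInstanceAs (Finite (Quotient G.V))
  -- Taking the constant path at a leaves v - 1 free values on paths, while functors correspond to
  -- arbitrary labels on the e oriented edges.
  let p : ∀ b, G.obj a ⟶ G.obj b :=
    Function.update (fun b => (hG.nonempty_hom a b).some) a (𝟙 _)
  have hp : p a = 𝟙 _ := Function.update_self _ _ _
  have h := Nat.card_congr (((functorEquivLabels (G := G) (Multiplicative (ZMod 2))).trans
    (labelsEquiv hO _)).symm.trans (Equiv.ofBijective _ (bijective_functor_restrict p hp)))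
  have hM : Nat.card (Multiplicative (ZMod 2)) = 2 := by
    rw [Nat.card_congr Multiplicative.toAdd, Nat.card_zmod]
  have hv : Nat.card {b : G.Vertex // b ≠ a} = G.v - 1 := by
    have := Fintype.ofFinite G.Vertex
    rw [v, Nat.card_eq_fintype_card, Nat.card_eq_fintype_card, Fintype.card_subtype_compl,
      Fintype.card_subtype_eq]
  rw [Nat.card_prod, Nat.card_fun, Nat.card_fun, hM, hv, Nat.card_coe_set_eq,
    ncard_orientation hO] at h
  exact h

theorem card_freeGroup_hom (ι : Type) [Finite ι] {Γ : Type} [Monoid Γ] (f : Γ ≃* FreeGroup ι) :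
    Nat.card (Γ →* Multiplicative (ZMod 2)) = 2 ^ Nat.card ι := by
  have hM : Nat.card (Multiplicative (ZMod 2)) = 2 := by
    rw [Nat.card_congr Multiplicative.toAdd, Nat.card_zmod]
  have h : Nat.card (ι → Multiplicative (ZMod 2)) = 2 ^ Nat.card ι := by rw [Nat.card_fun, hM]
  rw [← h]
  exact Nat.card_congr ((f.monoidHomCongrLeftEquiv).trans FreeGroup.lift.symm)

/-- The fundamental group of a connected graph is free of rank `1 - χ`. -/
theorem hasFreeFundGroup_iff (hE : ∀ h : G.H, G.E h ≠ h) (hG : G.Connected) (n : ℕ) :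
    G.HasFreeFundGroup n ↔ G.e + 1 = G.v + n := by
  have hfin : Finite G.Vertex := inferInstanceAs (Finite (Quotient G.V))
  have hv : 0 < G.v := by
    have : Nonempty G.Vertex := hG.1.map G.vert
    exact Nat.card_pos
  have key : ∀ (a : G.Vertex) (ι : Type) [Finite ι], (G.FundGroup a ≃* FreeGroup ι) →
      G.e + 1 = G.v + Nat.card ι := by
    intro a ι _ f
    have h := card_fundGroup_hom hE hG a
    rw [card_freeGroup_hom ι f, ← pow_add] at h
    have := Nat.pow_right_injective le_rfl h
    omega
  constructor
  · intro h
    obtain ⟨x⟩ := hG.1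
    obtain ⟨f⟩ := h (G.vert x)
    rw [key _ _ f, Nat.card_fin]
  · intro h a
    have hfree := isFreeGroup_fundGroup hE hG a
    obtain ⟨ι, ⟨b⟩⟩ := hfree.nonempty_basis
    have f : G.FundGroup a ≃* FreeGroup ι := b.repr
    -- An infinite basis would give infinitely many homomorphisms, for which `Nat.card` is 0,
    -- whereas the product in `card_fundGroup_hom` is 2 ^ e.
    have hι : Finite ι := by
      by_contra hι
      rw [not_finite_iff_infinite] at hι
      have h1 := card_fundGroup_hom hE hG a
      have h2 : Nat.card (G.FundGroup a →* Multiplicative (ZMod 2)) = 0 := by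
        have : Infinite (ι → Multiplicative (ZMod 2)) := inferInstance
        rw [Nat.card_congr ((f.monoidHomCongrLeftEquiv).trans FreeGroup.lift.symm)]
        exact Nat.card_eq_zero_of_infinite
      rw [h2, zero_mul] at h1
      exact absurd h1 (by positivity)
    have h1 := key a ι f
    exact ⟨f.trans (FreeGroup.freeGroupCongr (Finite.equivFinOfCardEq (by omega)))⟩

end HGraph

theorem ConnClass.generators_eq_classesOfEulerChar (n : ℕ) :
    GC2.generators (n + 1) = classesOfEulerChar n := by
  ext c
  change c.rep.HasFreeFundGroup (n + 1) ↔ c.rep.eulerChar = -(n : ℤ)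
  rw [HGraph.hasFreeFundGroup_iff c.rep_admissible.1 c.rep_connected, HGraph.eulerChar]
  omega

theorem mainTheorem1 (n : ℕ) (hn : 1 ≤ n) :
    (GC2.generators (n + 1)).Finite ∧
    (classesOfEulerChar n).Finite ∧
    GC2.orbifoldEulerChar (n + 1) = PowerSeries.coeff n seriesX ∧
    PowerSeries.coeff n seriesX =
      ∑ᶠ c ∈ classesOfEulerChar n, (-1 : ℚ) ^ c.rep.e / (Nat.card c.rep.Aut : ℚ) ∧
    GC2.orbifoldEulerChar (n + 1) =
      if Even n then 0 else -(bernoulli (n + 1) / ((n : ℚ) * ((n : ℚ) + 1))) := by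
  have hX : PowerSeries.coeff n seriesX =
      ∑ᶠ c ∈ classesOfEulerChar n, (-1 : ℚ) ^ c.rep.e / (Nat.card c.rep.Aut : ℚ) :=
    PowerSeries.coeff_mk _ _
  have hGC : GC2.orbifoldEulerChar (n + 1) =
      ∑ᶠ c ∈ classesOfEulerChar n, (-1 : ℚ) ^ c.rep.e / (Nat.card c.rep.Aut : ℚ) := by
    rw [GC2.orbifoldEulerChar, ConnClass.generators_eq_classesOfEulerChar]
    simp only [GC2.degree, mul_one_div]
  refine ⟨?_, ConnClass.finite_classesOfEulerChar n, hGC.trans hX.symm, hX, ?_⟩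
  · rw [ConnClass.generators_eq_classesOfEulerChar]
    exact ConnClass.finite_classesOfEulerChar n
  · rw [hGC, ConnClass.finsum_classesOfEulerChar,
      HGraph.coeff_ev_one_egf_totalConn_graphWeight (by omega)]
    split_ifs with h
    · rw [bernoulli_eq_zero_of_odd h.add_one (by omega), zero_div, neg_zero]
    · rfl
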